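/- For $\mu,\nu\in\mathbb C$ with $\nu\notin\mathbb Z$ and $z>0$, let $$s_{\mu,\nu}(z)=\frac{z^{\mu+1}}{(\mu-\nu+1)(\mu+\nu+1)}\,{}_1F_2\Big(1;\tfrac{\mu-\nu+3}{2},\tfrac{\mu+\nu+3}{2};-\tfrac{z^2}{4}\Big)$$ and let $$S_{\mu,\nu}(z)=s_{\mu,\nu}(z)+\frac{2^{\mu-1}\Gamma\big(\frac{\mu-\nu+1}{2}\big)\Gamma\big(\frac{\mu+\nu+1}{2}\big)}{\sin(\nu\pi)}\Big\{\cos\big(\tfrac{(\mu-\nu)\pi}{2}\big)J_{-\nu}(z)-\cos\big(\tfrac{(\mu+\nu)\pi}{2}\big)J_{\nu}(z)\Big\}$$ be the Lommel functions, where $J_\nu$ is the Bessel function of the first kind. If $\mu-\nu$ or $\mu+\nu$ is an odd negative integer, $S_{\mu,\nu}(z)$ is understood as the limit of the right-hand side in $\mu$. Let $\sigma_w(m)=\sum_{d\mid m}d^{w}$ for $w\in\mathbb C$, and let $\zeta$ be the Riemann zeta function. Let $0<\operatorname{Re}(s)<2$, and let $\alpha,\beta>0$ with $\alpha\beta=1$.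 Then $$\alpha^{s/2}\Big(2s(2\pi)^{s-\frac12}\sqrt{\alpha}\sum_{m=1}^{\infty}\sigma_{1-s}(m)\,m^{s-\frac12}S_{-s-\frac12,\frac12}(2\pi m\alpha)-\frac{\zeta(s)}{2\alpha^{s}}-\frac{\zeta(s-1)}{(s-1)\alpha}\Big)$$ $$=\beta^{s/2}\Big(2s(2\pi)^{s-\frac12}\sqrt{\beta}\sum_{m=1}^{\infty}\sigma_{1-s}(m)\,m^{s-\frac12}S_{-s-\frac12,\frac12}(2\pi m\beta)-\frac{\zeta(s)}{2\beta^{s}}-\frac{\zeta(s-1)}{(s-1)\beta}\Big),$$ where both series converge absolutely. At $s=1$ the function $s\mapsto\frac{\zeta(s)}{2\alpha^{s}}+\frac{\zeta(s-1)}{(s-1)\alpha}$ has a removable singularity (and likewise with $\beta$), and its value there is understood as its limit. More precisely, for all $a>0$ and $m\ge1$, the functions $\mu\mapsto S_{\mu,1/2}(2\pi ma)$ and $w\mapsto\frac{\zeta(w)}{2a^{w}}+\frac{\zeta(w-1)}{(w-1)a}$, with the values by limits just described, are continuous at $\mu=-s-\frac12$ and at $w=s$ respectively. -/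

import Mathlib

noncomputable section

namespace LommelZeta

open Complex Filter Topology

/-- The hypergeometric function `₁F₂(a; b₁, b₂; z)`, for `b₁, b₂` not in `{0, -1, -2, …}`.
Mathlib's `regularizedHGFun` is the series divided by `Γ(b₁) Γ(b₂)`. -/
def hypergeometric1F2 (a b₁ b₂ z : ℂ) : ℂ :=
  Gamma b₁ * Gamma b₂ * regularizedHGFun {a} {b₁, b₂} z

/-- The Bessel function of the first kind,
`J_ν(z) = ∑ₙ (-1)ⁿ / (n! Γ(ν + n + 1)) (z / 2)^(ν + 2n)`, for `z ≠ 0` (principal powers).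
Where `ν + n + 1` is a pole of `Γ` the term is `0`, as `Gamma` has the value `0` there. -/
def besselJ (ν z : ℂ) : ℂ :=
  ∑' n : ℕ, (-1 : ℂ) ^ n / ((n.factorial : ℂ) * Gamma (ν + n + 1)) * (z / 2) ^ (ν + 2 * n)

/-- The parameters at which the closed formulas of the Lommel functions degenerate:
one of `μ - ν`, `μ + ν` is an odd negative integer. -/
def IsExceptional (μ ν : ℂ) : Prop :=
  ∃ k : ℕ, μ - ν = -(2 * (k : ℂ) + 1) ∨ μ + ν = -(2 * (k : ℂ) + 1)

/-- The Lommel function `s_{μ,ν}(z)`, for non-exceptional `(μ, ν)`. -/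
def lommelSmall (μ ν z : ℂ) : ℂ :=
  z ^ (μ + 1) / ((μ - ν + 1) * (μ + ν + 1)) *
    hypergeometric1F2 1 (μ / 2 - ν / 2 + 3 / 2) (μ / 2 + ν / 2 + 3 / 2) (-(z ^ 2) / 4)

/-- The closed formula for the Lommel function `S_{μ,ν}(z)`, for `ν ∉ ℤ` and
non-exceptional `(μ, ν)`. -/
def lommelFormula (μ ν z : ℂ) : ℂ :=
  lommelSmall μ ν z +
    2 ^ (μ - 1) * Gamma ((μ - ν + 1) / 2) * Gamma ((μ + ν + 1) / 2) / sin (ν * Real.pi) *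
      (cos ((μ - ν) * Real.pi / 2) * besselJ (-ν) z - cos ((μ + ν) * Real.pi / 2) * besselJ ν z)

open Classical in
/-- The Lommel function `S_{μ,ν}(z)` for `ν ∉ ℤ`: the closed formula, and its limit in `μ`
at the exceptional parameters, where the formula has a removable singularity. -/
def lommelS (μ ν z : ℂ) : ℂ :=
  if IsExceptional μ ν then limUnder (𝓝[≠] μ) (fun μ' : ℂ => lommelFormula μ' ν z)
  else lommelFormula μ ν z

/-- The divisor sum `σ_w(n) = ∑_{d ∣ n} d ^ w` with a complex exponent, for `n ≥ 1`. -/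
def sigmaC (w : ℂ) (n : ℕ) : ℂ :=
  ∑ d ∈ n.divisors, (d : ℂ) ^ w

/-- `ζ(s) / (2 a^s) + ζ(s - 1) / ((s - 1) a)` for `s ≠ 1`. -/
def zetaFormula (a s : ℂ) : ℂ :=
  riemannZeta s / (2 * a ^ s) + riemannZeta (s - 1) / ((s - 1) * a)

open Classical in
/-- `ζ(s) / (2 a^s) + ζ(s - 1) / ((s - 1) a)`, with its removable singularity at `s = 1`
(the poles of the two terms cancel) filled by the limit. -/
def zetaTerms (a s : ℂ) : ℂ :=
  if s = 1 then limUnder (𝓝[≠] (1 : ℂ)) (zetaFormula a) else zetaFormula a s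

/-- `σ_{1-s}(m) m^(s-1/2) S_{-s-1/2,1/2}(2πma)`, the `m`-th term of the series. -/
def lommelTerm (s a : ℂ) (m : ℕ) : ℂ :=
  sigmaC (1 - s) m * (m : ℂ) ^ (s - 1 / 2) *
    lommelS (-s - 1 / 2) (1 / 2) (2 * Real.pi * m * a)

end LommelZeta

end

noncomputable section

namespace LommelZeta

open Complex Filter Topology MeasureTheory Set

/-! The engine is the integral representation S_{-s-1/2,1/2}(z) = z^(-1/2) / Γ(s+1) · ∫₀^∞ x^s
e^(-zx) / (1 + x²) dx (`lommelFormula_half`, `lommelS_half`). It holds because, up to the factor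
z^(-1/2), both sides solve one forced oscillator equation with the same behaviour at 0. The integral
is continuous in s, so it also supplies the limit value at s = 1.

Put z = 2πma and write m = dk. The substitution x = t/(2πk) turns each term into a sum over
factorizations of ∫ t^s e^(-adt) / (t² + 4π²k²) dt. The sum over d is geometric and the sum over k
is the partial fraction series of the cotangent. The Lommel series with its prefactor is therefore
the Mellin transform of `bose (a * t) * oddBose t`, divided by Γ(s)
(`prefactor_mul_tsum_lommelTerm`).

The zeta terms are likewise the Mellin transform of `zetaKernel a`, divided by Γ(s)
(`zetaTerms_eq`); this needs an analytic continuation from Re s > 2. With D(t) = 1/(e^t - 1) - 1/t,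
the difference of the two kernels is exactly D(t) D(at) (`lommel_sub_zetaTerms`). Rescaling t by α
exchanges D(t) D(αt) with D(t) D(βt) when αβ = 1, at the cost of α^(-s), which the factors α^(s/2)
and β^(s/2) absorb. -/

/-! ### Laplace transforms weighted by a complex power -/

/-- The Laplace transform at `z` of `x ↦ x ^ (w - 1) * g x`. -/
def laplacePow (g : ℝ → ℝ) (w : ℂ) (z : ℝ) : ℂ :=
  ∫ x in Ioi (0 : ℝ), (x : ℂ) ^ (w - 1) * ((g x * Real.exp (-z * x) : ℝ) : ℂ)

lemma measurable_cpow_ofReal (w : ℂ) : Measurable fun x : ℝ => (x : ℂ) ^ w :=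
  measurable_ofReal.pow_const w

lemma norm_cpow_mul_ofReal {x : ℝ} (hx : 0 < x) (w : ℂ) (y : ℝ) :
    ‖(x : ℂ) ^ (w - 1) * (y : ℂ)‖ = x ^ (w.re - 1) * |y| := by
  rw [norm_mul, norm_cpow_eq_rpow_re_of_pos hx, norm_real, sub_re, one_re, Real.norm_eq_abs]

lemma integrableOn_rpow_mul_exp {r z : ℝ} (hr : 0 < r) (hz : 0 < z) :
    IntegrableOn (fun x : ℝ => x ^ (r - 1) * Real.exp (-z * x)) (Ioi 0) := by
  have := integrableOn_rpow_mul_exp_neg_mul_rpow (p := 1) (s := r - 1) (b := z)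
    (by linarith) zero_lt_one hz
  simpa using this

lemma integrableOn_laplacePow {g : ℝ → ℝ} (hg : Measurable g) (hg1 : ∀ x, |g x| ≤ 1)
    {w : ℂ} (hw : 0 < w.re) {z : ℝ} (hz : 0 < z) :
    IntegrableOn (fun x : ℝ => (x : ℂ) ^ (w - 1) * ((g x * Real.exp (-z * x) : ℝ) : ℂ))
      (Ioi 0) := by
  refine (integrableOn_rpow_mul_exp hw hz).mono' ?_ ?_
  · exact ((measurable_cpow_ofReal _).mul (by fun_prop)).aestronglyMeasurable
  · refine (ae_restrict_iff' measurableSet_Ioi).2 (Eventually.of_forall fun x hx => ?_)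
    rw [norm_cpow_mul_ofReal hx, abs_mul, Real.abs_exp]
    have : (0 : ℝ) ≤ x ^ (w.re - 1) := Real.rpow_nonneg (le_of_lt hx) _
    gcongr
    have := hg1 x
    nlinarith [Real.exp_pos (-z * x)]

lemma hasDerivAt_laplacePow {g : ℝ → ℝ} (hg : Measurable g) (hg1 : ∀ x, |g x| ≤ 1)
    {w : ℂ} (hw : 0 < w.re) {z : ℝ} (hz : 0 < z) :
    HasDerivAt (laplacePow g w) (-laplacePow g (w + 1) z) z := by
  have hw' : 0 < (w + 1).re := by simp; linarith
  have key := hasDerivAt_integral_of_dominated_loc_of_deriv_le (𝕜 := ℝ)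
    (μ := volume.restrict (Ioi (0 : ℝ))) (s := Ioi (z / 2)) (x₀ := z)
    (F := fun z x => (x : ℂ) ^ (w - 1) * ((g x * Real.exp (-z * x) : ℝ) : ℂ))
    (F' := fun z x => -((x : ℂ) ^ (w + 1 - 1) * ((g x * Real.exp (-z * x) : ℝ) : ℂ)))
    (bound := fun x => x ^ ((w + 1).re - 1) * Real.exp (-(z / 2) * x))
    (Ioi_mem_nhds (by linarith))
    (Eventually.of_forall fun y =>
      ((measurable_cpow_ofReal _).mul (by fun_prop)).aestronglyMeasurable)
    (integrableOn_laplacePow hg hg1 hw hz)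
    ((measurable_cpow_ofReal _).mul (by fun_prop)).neg.aestronglyMeasurable
    ?_ (integrableOn_rpow_mul_exp hw' (by linarith)) ?_
  · have h := key.2
    rw [integral_neg] at h
    exact h
  · refine (ae_restrict_iff' measurableSet_Ioi).2 (Eventually.of_forall fun x hx y hy => ?_)
    have hx0 : (0 : ℝ) < x := hx
    have hy0 : z / 2 < y := hy
    rw [norm_neg, norm_cpow_mul_ofReal hx, abs_mul, Real.abs_exp]
    have h1 : Real.exp (-y * x) ≤ Real.exp (-(z / 2) * x) := Real.exp_le_exp.2 (by nlinarith)
    have : (0 : ℝ) ≤ x ^ ((w + 1).re - 1) := Real.rpow_nonneg (le_of_lt hx) _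
    gcongr
    have := hg1 x
    nlinarith [Real.exp_pos (-y * x)]
  · refine (ae_restrict_iff' measurableSet_Ioi).2 (Eventually.of_forall fun x hx y hy => ?_)
    have hx0 : (x : ℂ) ≠ 0 := ofReal_ne_zero.2 (ne_of_gt hx)
    have h1 : HasDerivAt (fun y : ℝ => g x * Real.exp (-y * x))
        (g x * (Real.exp (-y * x) * (-1 * x))) y :=
      ((((hasDerivAt_id y).neg).mul_const x).exp).const_mul _
    have h2 := (h1.ofReal_comp).const_mul ((x : ℂ) ^ (w - 1))
    refine h2.congr_deriv ?_
    rw [show w + 1 - 1 = (w - 1) + 1 by ring, cpow_add _ _ hx0, cpow_one]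
    push_cast
    ring

lemma tendsto_laplacePow_zero {g : ℝ → ℝ} (hg : Measurable g)
    {w : ℂ} (hi : IntegrableOn (fun x : ℝ => x ^ (w.re - 1) * |g x|) (Ioi 0)) :
    Tendsto (laplacePow g w) (𝓝[>] 0) (𝓝 (laplacePow g w 0)) := by
  refine tendsto_integral_filter_of_dominated_convergence _ ?_ ?_ hi ?_
  · exact Eventually.of_forall fun y =>
      ((measurable_cpow_ofReal _).mul (by fun_prop)).aestronglyMeasurable
  · filter_upwards [self_mem_nhdsWithin] with y hy
    refine (ae_restrict_iff' measurableSet_Ioi).2 (Eventually.of_forall fun x hx => ?_)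
    have hx0 : (0 : ℝ) < x := hx
    have hy0 : (0 : ℝ) < y := hy
    rw [norm_cpow_mul_ofReal hx, abs_mul, Real.abs_exp]
    have h1 : Real.exp (-y * x) ≤ 1 := Real.exp_le_one_iff.2 (by nlinarith)
    have : (0 : ℝ) ≤ x ^ (w.re - 1) := Real.rpow_nonneg hx0.le _
    gcongr
    nlinarith [abs_nonneg (g x)]
  · refine (ae_restrict_iff' measurableSet_Ioi).2 (Eventually.of_forall fun x hx => ?_)
    have : Continuous fun y : ℝ => (x : ℂ) ^ (w - 1) * ((g x * Real.exp (-y * x) : ℝ) : ℂ) := by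
      fun_prop
    exact this.tendsto' _ _ rfl |>.mono_left nhdsWithin_le_nhds

lemma laplacePow_one {w : ℂ} (hw : 0 < w.re) {z : ℝ} (hz : 0 < z) :
    laplacePow (fun _ => 1) w z = Gamma w * (z : ℂ) ^ (-w) := by
  have h := integral_cpow_mul_exp_neg_mul_Ioi (a := w) (r := z) hw (by exact_mod_cast hz)
  simp only [laplacePow, one_mul]
  rw [cpow_neg, mul_comm (Gamma w), ← one_div]
  have h2 : (1 / (z : ℂ)) ^ w = 1 / (z : ℂ) ^ w := by
    rw [one_div, inv_cpow _ _ (by rw [arg_ofReal_of_nonneg hz.le]; exact Real.pi_pos.ne), one_div]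
  rw [← h2, ← h]
  simp [neg_mul]

/-! ### The kernels (1 + x²)^(-k): recurrences and values at z = 0 -/

/-- The kernel `(1 + x ^ 2) ^ (-k)`. -/
def cauchyKernel (k : ℕ) (x : ℝ) : ℝ := ((1 + x ^ 2) ^ k)⁻¹

lemma continuous_cauchyKernel (k : ℕ) : Continuous (cauchyKernel k) := by
  unfold cauchyKernel
  exact Continuous.inv₀ (by fun_prop) fun x => by positivity

lemma cauchyKernel_pos (k : ℕ) (x : ℝ) : 0 < cauchyKernel k x := by
  unfold cauchyKernel; positivity

lemma abs_cauchyKernel_le_one (k : ℕ) (x : ℝ) : |cauchyKernel k x| ≤ 1 := by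
  rw [abs_of_pos (cauchyKernel_pos k x)]
  exact inv_le_one_of_one_le₀ (one_le_pow₀ (by nlinarith [sq_nonneg x]))

/-- The factor 1 + x² cancels the kernel. As two derivatives in z raise w by 2, this is the equation
y'' + y = Γ(w) z^(-w). -/
lemma laplacePow_cauchyKernel_add {w : ℂ} (hw : 0 < w.re) {z : ℝ} (hz : 0 < z) :
    laplacePow (cauchyKernel 1) w z + laplacePow (cauchyKernel 1) (w + 2) z
      = Gamma w * (z : ℂ) ^ (-w) := by
  rw [← laplacePow_one hw hz]
  have hm := (continuous_cauchyKernel 1).measurable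
  unfold laplacePow
  rw [← integral_add (integrableOn_laplacePow hm (abs_cauchyKernel_le_one 1) hw hz)
    (integrableOn_laplacePow hm (abs_cauchyKernel_le_one 1) (by simp; linarith) hz)]
  refine setIntegral_congr_fun measurableSet_Ioi fun x hx => ?_
  have hx0 : (x : ℂ) ≠ 0 := ofReal_ne_zero.2 (ne_of_gt hx)
  have h1 : (1 + (x : ℂ) ^ 2) ≠ 0 := by
    exact_mod_cast (by positivity : (0 : ℝ) < 1 + x ^ 2).ne'
  simp only [cauchyKernel]
  rw [show w + 2 - 1 = (w - 1) + (2 : ℕ) by push_cast; ring, cpow_add _ _ hx0, cpow_natCast]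
  push_cast
  field_simp

/-- Euler's Beta integral: (1 + u)^(-k) is expanded as a Gamma integral and the order of integration
is exchanged. Integrability on the product also yields the convergence claim. -/
lemma mellin_one_add_inv (k : ℕ) {v : ℂ} (hv : 0 < v.re) (hvk : v.re < k) :
    MellinConvergent (fun x : ℝ => ((((1 + x) ^ k)⁻¹ : ℝ) : ℂ)) v ∧
    Gamma k * mellin (fun x : ℝ => ((((1 + x) ^ k)⁻¹ : ℝ) : ℂ)) v = Gamma v * Gamma (k - v) := by
  have hk : 0 < (k : ℂ).re := by simp only [natCast_re]; linarith
  have hkv : 0 < ((k : ℂ) - v).re := by simp only [sub_re, natCast_re]; linarith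
  have hΓ : Gamma (k : ℂ) ≠ 0 := Gamma_ne_zero_of_re_pos hk
  set F : ℝ × ℝ → ℂ := fun p => (p.1 : ℂ) ^ (v - 1) *
    ((p.2 : ℂ) ^ ((k : ℂ) - 1) * ((Real.exp (-((1 + p.1) * p.2)) : ℝ) : ℂ)) with hF
  have hFm : Measurable F :=
    ((measurable_cpow_ofReal _).comp measurable_fst).mul
      (((measurable_cpow_ofReal _).comp measurable_snd).mul (by fun_prop))
  have hnorm : ∀ t ∈ Ioi (0 : ℝ), ∀ u ∈ Ioi (0 : ℝ), ‖F (u, t)‖ =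
      t ^ ((k : ℝ) - 1) * Real.exp (-t) * (u ^ (v.re - 1) * Real.exp (-(t * u))) := by
    intro t ht u hu
    simp only [hF]
    rw [norm_mul, norm_cpow_mul_ofReal ht, norm_cpow_eq_rpow_re_of_pos hu, Real.abs_exp,
      show -((1 + u) * t) = -t + -(t * u) by ring, Real.exp_add]
    simp only [sub_re, one_re, natCast_re]
    ring
  have hint : ∀ t ∈ Ioi (0 : ℝ), Integrable (fun u => F (u, t))
      (volume.restrict (Ioi (0 : ℝ))) := by
    intro t ht
    refine Integrable.mono'
      ((integrableOn_rpow_mul_exp hv ht).const_mul (t ^ ((k : ℝ) - 1) * Real.exp (-t)))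
      (hFm.comp (measurable_id.prodMk measurable_const)).aestronglyMeasurable ?_
    refine (ae_restrict_iff' measurableSet_Ioi).2 (Eventually.of_forall fun u hu => ?_)
    rw [hnorm t ht u hu, neg_mul]
  have hprod : Integrable F
      ((volume.restrict (Ioi (0 : ℝ))).prod (volume.restrict (Ioi (0 : ℝ)))) := by
    rw [integrable_prod_iff' hFm.aestronglyMeasurable]
    refine ⟨(ae_restrict_iff' measurableSet_Ioi).2 (Eventually.of_forall hint), ?_⟩
    have h := (integrableOn_rpow_mul_exp hkv one_pos).const_mul (Real.Gamma v.re)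
    refine IntegrableOn.congr_fun h (fun t ht => ?_) measurableSet_Ioi
    have ht0 : (0 : ℝ) < t := ht
    rw [setIntegral_congr_fun measurableSet_Ioi (hnorm t ht), integral_const_mul,
      Real.integral_rpow_mul_exp_neg_mul_Ioi hv ht0]
    simp only [sub_re, natCast_re, neg_mul, one_mul]
    rw [show (k : ℝ) - v.re - 1 = ((k : ℝ) - 1) + (-v.re) by ring, Real.rpow_add ht0,
      Real.rpow_neg ht0.le, one_div, Real.inv_rpow ht0.le]
    ring
  have hleft : ∀ u ∈ Ioi (0 : ℝ), ∫ t in Ioi (0 : ℝ), F (u, t) =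
      Gamma k * ((u : ℂ) ^ (v - 1) • ((((1 + u) ^ k)⁻¹ : ℝ) : ℂ)) := by
    intro u hu
    have hu0 : (0 : ℝ) < u := hu
    simp only [hF]
    rw [integral_const_mul]
    have h := integral_cpow_mul_exp_neg_mul_Ioi (a := (k : ℂ)) (r := 1 + u) hk
      (by linarith)
    push_cast at h ⊢
    rw [h, cpow_natCast, smul_eq_mul, one_div, inv_pow]
    ring
  have hright : ∀ t ∈ Ioi (0 : ℝ), ∫ u in Ioi (0 : ℝ), F (u, t) =
      Gamma v * ((t : ℂ) ^ ((k : ℂ) - v - 1) * ((1 * Real.exp (-1 * t) : ℝ) : ℂ)) := by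
    intro t ht
    have ht0 : (0 : ℝ) < t := ht
    have htc : (t : ℂ) ≠ 0 := ofReal_ne_zero.2 ht0.ne'
    have h := laplacePow_one hv ht0
    simp only [laplacePow] at h
    have h1 : ∀ u : ℝ, F (u, t) = ((t : ℂ) ^ ((k : ℂ) - 1) * ((Real.exp (-t) : ℝ) : ℂ)) *
        ((u : ℂ) ^ (v - 1) * ((1 * Real.exp (-t * u) : ℝ) : ℂ)) := by
      intro u
      simp only [hF]
      rw [show -((1 + u) * t) = -t + -t * u by ring, Real.exp_add]
      push_cast
      ring
    simp_rw [h1]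
    rw [integral_const_mul, h, show (k : ℂ) - v - 1 = ((k : ℂ) - 1) + -v by ring,
      cpow_add _ _ htc, one_mul, neg_one_mul]
    ring
  have hconv : MellinConvergent (fun x : ℝ => ((((1 + x) ^ k)⁻¹ : ℝ) : ℂ)) v := by
    have h := (hprod.integral_prod_left).const_mul (Gamma (k : ℂ))⁻¹
    refine IntegrableOn.congr_fun h (fun u hu => ?_) measurableSet_Ioi
    simp only
    rw [hleft u hu, inv_mul_cancel_left₀ hΓ]
  refine ⟨hconv, ?_⟩
  have hswap := integral_integral_swap (f := fun u t => F (u, t)) hprod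
  rw [setIntegral_congr_fun measurableSet_Ioi hleft,
    setIntegral_congr_fun measurableSet_Ioi hright, integral_const_mul, integral_const_mul] at hswap
  have h3 := laplacePow_one hkv one_pos
  simp only [laplacePow] at h3
  rw [mellin, hswap, h3]
  simp

/-- The substitution u = x² reduces this to the Beta integral. The cases k = 1 and k = 2 provide the
initial data of the differential equation. -/
lemma laplacePow_cauchyKernel_zero (k : ℕ) {w : ℂ} (hw : 0 < w.re)
    (hwk : w.re < 2 * k) :
    IntegrableOn (fun x : ℝ => x ^ (w.re - 1) * |cauchyKernel k x|) (Ioi 0) ∧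
    2 * Gamma k * laplacePow (cauchyKernel k) w 0 = Gamma (w / 2) * Gamma (k - w / 2) := by
  have h2 : (w / 2).re = w.re / 2 := by simp
  obtain ⟨h, h'⟩ := mellin_one_add_inv k (v := w / 2) (by linarith) (by linarith)
  have e : (fun t : ℝ => ((((1 + t ^ (2 : ℝ)) ^ k)⁻¹ : ℝ) : ℂ)) =
      fun t => ((cauchyKernel k t : ℝ) : ℂ) := by
    ext t; simp [cauchyKernel]
  have hc := (MellinConvergent.comp_rpow (f := fun x : ℝ => ((((1 + x) ^ k)⁻¹ : ℝ) : ℂ)) (s := w)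
    (a := 2) two_ne_zero).2 (by simpa using h)
  have hm := mellin_comp_rpow (fun x : ℝ => ((((1 + x) ^ k)⁻¹ : ℝ) : ℂ)) w 2
  rw [e] at hc hm
  constructor
  · refine IntegrableOn.congr_fun (Integrable.norm hc) (fun x hx => ?_) measurableSet_Ioi
    simp only [smul_eq_mul]
    rw [norm_cpow_mul_ofReal hx]
  · have : laplacePow (cauchyKernel k) w 0 = mellin (fun t => ((cauchyKernel k t : ℝ) : ℂ)) w := by
      simp [laplacePow, mellin]
    rw [this, hm, ← h']
    simp only [real_smul, ofReal_ofNat]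
    rw [abs_of_pos two_pos]
    push_cast
    ring

/-- The derivative of x^(s+1) e^(-zx) / (1 + x²) integrates to 0 over the half-line. The gain is at
z → 0: the first integral may diverge there when Re s ≥ 1, whereas the one with `cauchyKernel 2`
converges throughout the strip. -/
lemma laplacePow_cauchyKernel_parts {s : ℂ} (hs : 0 < s.re) {z : ℝ} (hz : 0 < z) :
    (s - 1) * laplacePow (cauchyKernel 1) (s + 1) z
      - z * laplacePow (cauchyKernel 1) (s + 2) z
      + 2 * laplacePow (cauchyKernel 2) (s + 1) z = 0 := by
  have hm1 := (continuous_cauchyKernel 1).measurable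
  have hm2 := (continuous_cauchyKernel 2).measurable
  have hs1 : 0 < (s + 1).re := by simp; linarith
  have hs2 : 0 < (s + 2).re := by simp; linarith
  have i1 := (integrableOn_laplacePow hm1 (abs_cauchyKernel_le_one 1) hs1 hz).const_mul (s - 1)
  have i2 := (integrableOn_laplacePow hm1 (abs_cauchyKernel_le_one 1) hs2 hz).const_mul (z : ℂ)
  have i3 := (integrableOn_laplacePow hm2 (abs_cauchyKernel_le_one 2) hs1 hz).const_mul 2
  set f : ℝ → ℂ := fun x => (x : ℂ) ^ (s + 1) *
    ((cauchyKernel 1 x * Real.exp (-z * x) : ℝ) : ℂ) with hf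
  have hs10 : s + 1 ≠ 0 := fun h => by rw [h] at hs1; simp at hs1
  have hd : ∀ x ∈ Ioi (0 : ℝ), HasDerivAt f
      ((s - 1) * ((x : ℂ) ^ (s + 1 - 1) * ((cauchyKernel 1 x * Real.exp (-z * x) : ℝ) : ℂ))
      - z * ((x : ℂ) ^ (s + 2 - 1) * ((cauchyKernel 1 x * Real.exp (-z * x) : ℝ) : ℂ))
      + 2 * ((x : ℂ) ^ (s + 1 - 1) * ((cauchyKernel 2 x * Real.exp (-z * x) : ℝ) : ℂ))) x := by
    intro x hx
    have hx0 : (0 : ℝ) < x := hx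
    have hxc : (x : ℂ) ≠ 0 := ofReal_ne_zero.2 hx0.ne'
    have d1 : HasDerivAt (fun x : ℝ => (x : ℂ) ^ (s + 1)) ((s + 1) * (x : ℂ) ^ s) x := by
      simpa using hasDerivAt_ofReal_cpow_const hx0.ne' hs10
    have d2 : HasDerivAt (cauchyKernel 1) (-(2 * x) / (1 + x ^ 2) ^ 2) x := by
      have h1 : HasDerivAt (fun x : ℝ => (1 + x ^ 2) ^ 1) (2 * x) x := by
        simpa using (hasDerivAt_pow 2 x).const_add 1
      refine (h1.inv (by positivity)).congr_deriv ?_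
      simp
    have d3 : HasDerivAt (fun x : ℝ => Real.exp (-z * x)) (Real.exp (-z * x) * (-z * 1)) x :=
      ((hasDerivAt_id x).const_mul (-z)).exp
    have d4 := d1.mul (d2.mul d3).ofReal_comp
    refine d4.congr_deriv ?_
    have h1 : (1 + (x : ℂ) ^ 2) ≠ 0 := by
      exact_mod_cast (by positivity : (0 : ℝ) < 1 + x ^ 2).ne'
    simp only [cauchyKernel, Pi.mul_apply]
    rw [show s + 1 - 1 = s by ring, show s + 2 - 1 = s + 1 by ring, cpow_add _ _ hxc, cpow_one]
    push_cast
    field_simp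
    ring
  have hbound : ∀ x : ℝ, 0 < x → ‖f x‖ ≤ x ^ (s.re + 1) * Real.exp (-z * x) := by
    intro x hx
    have := norm_cpow_mul_ofReal hx (s + 2) (cauchyKernel 1 x * Real.exp (-z * x))
    rw [show s + 2 - 1 = s + 1 by ring] at this
    simp only [hf]
    rw [this, abs_mul, Real.abs_exp]
    have e1 : (s + 2).re - 1 = s.re + 1 := by simp; ring
    rw [e1]
    have : (0 : ℝ) ≤ x ^ (s.re + 1) := Real.rpow_nonneg hx.le _
    gcongr
    have := abs_cauchyKernel_le_one 1 x
    nlinarith [Real.exp_pos (-z * x)]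
  have hcont : ContinuousAt f 0 := by
    refine ContinuousAt.mul ?_ ?_
    · exact (continuousAt_cpow_const_of_re_pos (Or.inl (by simp)) hs1).comp
        (f := fun x : ℝ => (x : ℂ)) continuous_ofReal.continuousAt
    · exact (continuous_ofReal.comp ((continuous_cauchyKernel 1).mul (by fun_prop))).continuousAt
  have htop : Tendsto f atTop (𝓝 0) := by
    refine squeeze_zero_norm' ((eventually_gt_atTop 0).mono hbound) ?_
    exact tendsto_rpow_mul_exp_neg_mul_atTop_nhds_zero _ _ hz
  have key := integral_Ioi_of_hasDerivAt_of_tendsto (f := f) (a := 0) (m := 0)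
    hcont.continuousWithinAt hd ((i1.sub i2).add i3) htop
  rw [show f 0 = 0 by simp [hf, zero_cpow hs10], sub_zero] at key
  rw [← key]
  unfold laplacePow
  rw [← integral_const_mul, ← integral_const_mul, ← integral_const_mul]
  exact (congrArg (· + _) (integral_sub i1 i2)).symm.trans (integral_add (i1.sub i2) i3).symm

/-! ### The alternating series and the oscillator equation -/

/-- The monomials `x ^ (c + j - 1) / Γ (c + j)`, each the derivative of the next. -/
def gammaMonomial (c : ℂ) (j : ℕ) (x : ℝ) : ℂ := (x : ℂ) ^ (c + j - 1) / Gamma (c + j)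

/-- The alternating series of the monomials of index `i, i + 2, i + 4, …`. -/
def gammaSeries (c : ℂ) (i : ℕ) (x : ℝ) : ℂ := ∑' n : ℕ, (-1) ^ n * gammaMonomial c (2 * n + i) x

lemma Gamma_add_nat_ne_zero {c : ℂ} (hc : 0 < c.re) (j : ℕ) : Gamma (c + j) ≠ 0 :=
  Gamma_ne_zero_of_re_pos (by simp only [add_re, natCast_re]; positivity)

lemma add_nat_ne_zero {c : ℂ} (hc : 0 < c.re) (j : ℕ) : c + j ≠ 0 := fun h => by
  have : (c + j).re = 0 := by rw [h]; simp
  simp only [add_re, natCast_re] at this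
  have : (0 : ℝ) ≤ j := by positivity
  linarith

lemma hasDerivAt_gammaMonomial {c : ℂ} (hc : 0 < c.re) (j : ℕ) {x : ℝ} (hx : 0 < x) :
    HasDerivAt (gammaMonomial c (j + 1)) (gammaMonomial c j x) x := by
  have hcj := add_nat_ne_zero hc j
  have h := (hasDerivAt_ofReal_cpow_const hx.ne' hcj).div_const (Gamma (c + j + 1))
  unfold gammaMonomial
  have e : c + (j + 1 : ℕ) = c + j + 1 := by push_cast; ring
  simp only [e, add_sub_cancel_right]
  refine h.congr_deriv ?_
  rw [Gamma_add_one _ hcj]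
  have := Gamma_add_nat_ne_zero hc j
  field_simp

lemma norm_gammaMonomial (c : ℂ) (j : ℕ) {x : ℝ} (hx : 0 < x) :
    ‖gammaMonomial c j x‖ = x ^ (c.re - 1) * (x ^ j / ‖Gamma (c + j)‖) := by
  rw [gammaMonomial, norm_div, norm_cpow_eq_rpow_re_of_pos hx,
    show (c + j - 1).re = (c.re - 1) + j by simp; ring, Real.rpow_add hx, Real.rpow_natCast]
  ring

lemma summable_pow_div_norm_Gamma {c : ℂ} (hc : 0 < c.re) {r : ℝ} (hr : 0 < r) :
    Summable fun j : ℕ => r ^ j / ‖Gamma (c + j)‖ := by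
  have hG := Gamma_add_nat_ne_zero hc
  refine summable_of_ratio_test_tendsto_lt_one zero_lt_one
    (Eventually.of_forall fun j => (div_pos (by positivity) (norm_pos_iff.2 (hG j))).ne') ?_
  have h1 : ∀ j : ℕ, ‖r ^ (j + 1) / ‖Gamma (c + (j + 1 : ℕ))‖‖ / ‖r ^ j / ‖Gamma (c + j)‖‖
      = r / ‖c + j‖ := by
    intro j
    have hcj := add_nat_ne_zero hc j
    have e : c + (j + 1 : ℕ) = c + j + 1 := by push_cast; ring
    rw [e, Gamma_add_one _ hcj, norm_mul, norm_div, norm_div, norm_mul, norm_norm, norm_norm,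
      norm_pow, norm_pow, Real.norm_of_nonneg hr.le]
    have := norm_pos_iff.2 (hG j)
    have := norm_pos_iff.2 hcj
    field_simp
    rw [pow_succ]
  simp_rw [h1]
  refine Tendsto.div_atTop tendsto_const_nhds ?_
  refine tendsto_atTop_mono (f := fun j : ℕ => (j : ℝ)) (fun j => ?_) tendsto_natCast_atTop_atTop
  refine le_trans ?_ (re_le_norm _)
  simp only [add_re, natCast_re]
  linarith

/-- Covers exponents of either sign, giving a uniform bound on compact intervals for termwise
differentiation. -/
lemma rpow_le_add_rpow {a b y : ℝ} (ha : 0 < a) (hay : a ≤ y) (hyb : y ≤ b) (p : ℝ) :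
    y ^ p ≤ a ^ p + b ^ p := by
  have hy : 0 < y := by linarith
  have h1 : 0 ≤ a ^ p := Real.rpow_nonneg ha.le _
  have h2 : 0 ≤ b ^ p := Real.rpow_nonneg (by linarith) _
  rcases le_total 0 p with hp | hp
  · have := Real.rpow_le_rpow hy.le hyb hp
    linarith
  · have := Real.rpow_le_rpow_of_nonpos ha hay hp
    linarith

lemma summable_gammaSeries_bound {c : ℂ} (hc : 0 < c.re) (i : ℕ) {r : ℝ} (hr : 0 < r) :
    Summable fun n : ℕ => r ^ (2 * n + i) / ‖Gamma (c + (2 * n + i : ℕ))‖ :=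
  (summable_pow_div_norm_Gamma hc hr).comp_injective fun a b (h : 2 * a + i = 2 * b + i) => by
    omega

lemma summable_gammaSeries {c : ℂ} (hc : 0 < c.re) (i : ℕ) {x : ℝ} (hx : 0 < x) :
    Summable fun n : ℕ => (-1) ^ n * gammaMonomial c (2 * n + i) x := by
  refine Summable.of_norm ?_
  simp only [norm_mul, norm_pow, norm_neg, norm_one, one_pow, one_mul, norm_gammaMonomial _ _ hx]
  exact (summable_gammaSeries_bound hc i hx).mul_left _

lemma hasDerivAt_gammaSeries {c : ℂ} (hc : 0 < c.re) (i : ℕ) {x : ℝ} (hx : 0 < x) :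
    HasDerivAt (gammaSeries c (i + 1)) (gammaSeries c i x) x := by
  have hmem : x ∈ Ioo (x / 2) (2 * x) := ⟨by linarith, by linarith⟩
  refine hasDerivAt_tsum_of_isPreconnected (𝕜 := ℝ) (t := Ioo (x / 2) (2 * x))
    (u := fun n => ((x / 2) ^ (c.re - 1) + (2 * x) ^ (c.re - 1)) *
      ((2 * x) ^ (2 * n + i) / ‖Gamma (c + (2 * n + i : ℕ))‖))
    (g := fun n y => (-1) ^ n * gammaMonomial c (2 * n + (i + 1)) y)
    (g' := fun n y => (-1) ^ n * gammaMonomial c (2 * n + i) y) (y₀ := x)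
    ((summable_gammaSeries_bound hc i (by linarith)).mul_left _) isOpen_Ioo
    isPreconnected_Ioo ?_ ?_ hmem (summable_gammaSeries hc _ hx) hmem
  · intro n y hy
    exact (hasDerivAt_gammaMonomial hc _ (by linarith [hy.1] : 0 < y)).const_mul _
  · intro n y hy
    have hy0 : 0 < y := by linarith [hy.1]
    rw [norm_mul, norm_pow, norm_neg, norm_one, one_pow, one_mul, norm_gammaMonomial _ _ hy0]
    have := rpow_le_add_rpow (by linarith) hy.1.le hy.2.le (c.re - 1)
    have := hy.2.le
    gcongr

/-- Since `gammaSeries c 0` is the second derivative of `gammaSeries c 2`, splitting off its first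
term exhibits the latter as a solution of y'' + y = x^(c-1) / Γ(c). -/
lemma gammaSeries_zero {c : ℂ} (hc : 0 < c.re) {x : ℝ} (hx : 0 < x) :
    gammaSeries c 0 x = (x : ℂ) ^ (c - 1) / Gamma c - gammaSeries c 2 x := by
  have h := (summable_gammaSeries hc 0 hx).tsum_eq_zero_add
  rw [gammaSeries, h, gammaSeries, sub_eq_add_neg, ← tsum_neg]
  congr 1
  · simp [gammaMonomial]
  · refine tsum_congr fun n => ?_
    rw [show 2 * (n + 1) + 0 = 2 * n + 2 by ring]
    ring

lemma tendsto_gammaSeries_zero {c : ℂ} (hc : 0 < c.re) (i : ℕ) :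
    Tendsto (gammaSeries c (i + 1)) (𝓝[>] 0) (𝓝 0) := by
  set C := ∑' n : ℕ, (1 : ℝ) ^ (2 * n + (i + 1)) / ‖Gamma (c + (2 * n + (i + 1) : ℕ))‖ with hC
  have hb : ∀ᶠ x : ℝ in 𝓝[>] 0, ‖gammaSeries c (i + 1) x‖ ≤ x ^ c.re * C := by
    filter_upwards [Ioo_mem_nhdsGT (zero_lt_one' ℝ)] with x hx
    refine tsum_of_norm_bounded
      ((summable_gammaSeries_bound hc (i + 1) one_pos).hasSum.mul_left (x ^ c.re)) fun n => ?_
    rw [norm_mul, norm_pow, norm_neg, norm_one, one_pow, one_mul, norm_gammaMonomial _ _ hx.1]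
    have e : x ^ c.re = x ^ (c.re - 1) * x := by
      rw [← Real.rpow_add_one hx.1.ne']; ring_nf
    rw [e, mul_assoc, one_pow]
    -- All indices are at least 1, so one factor x can be split off and the rest bounded by its
    -- value at x = 1.
    have h1 : x ^ (2 * n + (i + 1)) ≤ x := by
      simpa using pow_le_pow_of_le_one hx.1.le hx.2.le (show 1 ≤ 2 * n + (i + 1) by omega)
    have : 0 ≤ x ^ (c.re - 1) := Real.rpow_nonneg hx.1.le _
    rw [← mul_div_assoc x, mul_one]
    gcongr
  refine squeeze_zero_norm' hb ?_
  have : Tendsto (fun x : ℝ => x ^ c.re * C) (𝓝 0) (𝓝 (0 ^ c.re * C)) :=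
    ((Real.continuousAt_rpow_const _ _ (Or.inr hc.le)).mul continuousAt_const)
  rw [Real.zero_rpow hc.ne', zero_mul] at this
  exact this.mono_left nhdsWithin_le_nhds

/-- A solution of `f'' = -f` on `(0, ∞)` whose initial data vanish is zero. -/
lemma eq_zero_of_hasDerivAt_neg {f f' : ℝ → ℂ} (h : ∀ x, 0 < x → HasDerivAt f (f' x) x)
    (h' : ∀ x, 0 < x → HasDerivAt f' (-f x) x) (h0 : Tendsto f (𝓝[>] 0) (𝓝 0))
    (h0' : Tendsto f' (𝓝[>] 0) (𝓝 0)) {x : ℝ} (hx : 0 < x) : f x = 0 := by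
  have hs : ∀ x : ℝ, HasDerivAt (fun x : ℝ => sin (x : ℂ)) (cos x) x := fun x =>
    (hasDerivAt_sin (x : ℂ)).comp_ofReal
  have hc : ∀ x : ℝ, HasDerivAt (fun x : ℝ => cos (x : ℂ)) (-sin x) x := fun x =>
    (hasDerivAt_cos (x : ℂ)).comp_ofReal
  have const : ∀ g : ℝ → ℂ, (∀ x, 0 < x → HasDerivAt g 0 x) → Tendsto g (𝓝[>] 0) (𝓝 0) →
      ∀ x, 0 < x → g x = 0 := by
    intro g hg hg0 x hx
    have hcst : ∀ y ∈ Ioi (0 : ℝ), g y = g x := fun y hy =>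
      isOpen_Ioi.is_const_of_deriv_eq_zero isPreconnected_Ioi
        (fun z hz => (hg z hz).differentiableAt.differentiableWithinAt)
        (fun z hz => (hg z hz).deriv) hy hx
    have : Tendsto g (𝓝[>] 0) (𝓝 (g x)) :=
      tendsto_const_nhds.congr' (by filter_upwards [self_mem_nhdsWithin] with y hy
                                    using (hcst y hy).symm)
    exact tendsto_nhds_unique this hg0
  have l0 : Tendsto (fun x : ℝ => sin (x : ℂ)) (𝓝[>] 0) (𝓝 0) :=
    ((hs 0).continuousAt.tendsto.mono_left nhdsWithin_le_nhds).trans (by simp)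
  have l1 : Tendsto (fun x : ℝ => cos (x : ℂ)) (𝓝[>] 0) (𝓝 1) :=
    ((hc 0).continuousAt.tendsto.mono_left nhdsWithin_le_nhds).trans (by simp)
  -- Rotating the vector (f, f') by the angle x gives two constants of motion; both tend to 0 at the
  -- origin.
  have e1 := const (fun x => f x * cos x - f' x * sin x) (fun x hx =>
    (((h x hx).mul (hc x)).sub ((h' x hx).mul (hs x))).congr_deriv (by ring))
    (by simpa using (h0.mul l1).sub (h0'.mul l0)) x hx
  have e2 := const (fun x => f x * sin x + f' x * cos x) (fun x hx =>
    (((h x hx).mul (hs x)).add ((h' x hx).mul (hc x))).congr_deriv (by ring))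
    (by simpa using (h0.mul l0).add (h0'.mul l1)) x hx
  have := sin_sq_add_cos_sq (x : ℂ)
  linear_combination cos (x : ℂ) * e1 + sin (x : ℂ) * e2 - f x * this

lemma sub_one_ne_neg_nat {s : ℂ} (hs0 : 0 < s.re) (hs1 : s ≠ 1) (n : ℕ) :
    s - 1 ≠ -n := by
  intro h
  have hn : (n : ℝ) = 1 - s.re := by
    have := congrArg re h
    simp at this
    linarith
  have : n = 0 := by
    by_contra h0
    have : (1 : ℝ) ≤ n := by exact_mod_cast Nat.one_le_iff_ne_zero.2 h0
    linarith
  subst this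
  apply hs1
  linear_combination h

/-- If the sine were 0, the reflection formula, with division by zero giving 0, would make a product
of two nonzero Gamma values vanish. -/
lemma sin_pi_mul_div_two_ne_zero {s : ℂ} (hs0 : 0 < s.re) (hs2 : s.re < 2) :
    sin (Real.pi * s / 2) ≠ 0 := by
  have h := Gamma_mul_Gamma_one_sub (s / 2)
  intro h0
  rw [show (Real.pi : ℂ) * (s / 2) = Real.pi * s / 2 by ring, h0, div_zero] at h
  have h1 : Gamma (s / 2) ≠ 0 := Gamma_ne_zero_of_re_pos (by simp; linarith)
  have h2 : Gamma (1 - s / 2) ≠ 0 := Gamma_ne_zero_of_re_pos (by simp; linarith)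
  exact mul_ne_zero h1 h2 h

lemma Gamma_mul_Gamma_strip {s : ℂ} (hs0 : 0 < s.re) (hs2 : s.re < 2) (hs1 : s ≠ 1) :
    sin (Real.pi * s) ≠ 0 ∧
    Gamma (s - 1) * Gamma (2 - s) = -Real.pi / sin (Real.pi * s) := by
  have h := Gamma_mul_Gamma_one_sub (s - 1)
  rw [show 1 - (s - 1) = 2 - s by ring, show (Real.pi : ℂ) * (s - 1) = Real.pi * s - Real.pi by ring,
    sin_sub_pi] at h
  refine ⟨fun h0 => ?_, by rw [h]; ring⟩
  rw [h0, neg_zero, div_zero] at h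
  have h1 : Gamma (s - 1) ≠ 0 := Gamma_ne_zero (sub_one_ne_neg_nat hs0 hs1)
  have h2 : Gamma (2 - s) ≠ 0 := Gamma_ne_zero_of_re_pos (by simp; linarith)
  exact mul_ne_zero h1 h2 h

/-- Uniqueness for y'' + y = Γ(s-1) x^(1-s): the Laplace side and the series side satisfy it with
equal initial data, found from the Beta integrals. -/
lemma laplacePow_cauchyKernel_eq_series {s : ℂ} (hs0 : 0 < s.re) (hs2 : s.re < 2) (hs1 : s ≠ 1)
    {z : ℝ} (hz : 0 < z) :
    laplacePow (cauchyKernel 1) (s + 1) z =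
      Gamma (s - 1) * Gamma (2 - s) *
        (gammaSeries (2 - s) 0 z - sin (z + Real.pi * s / 2)) := by
  have hm := (continuous_cauchyKernel 1).measurable
  have hm2 := (continuous_cauchyKernel 2).measurable
  have hb := abs_cauchyKernel_le_one 1
  have hc : 0 < (2 - s).re := by simp; linarith
  have hs1' : 0 < (s + 1).re := by simp; linarith
  have hs1ne : s - 1 ≠ 0 := sub_ne_zero.2 hs1
  have hΓc : Gamma (2 - s) ≠ 0 := Gamma_ne_zero_of_re_pos hc
  obtain ⟨hsin, hΓΓ⟩ := Gamma_mul_Gamma_strip hs0 hs2 hs1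
  have hsin2 := sin_pi_mul_div_two_ne_zero hs0 hs2
  have hdouble : sin (Real.pi * s) = 2 * sin (Real.pi * s / 2) * cos (Real.pi * s / 2) := by
    rw [← sin_two_mul]; congr 1; ring
  have hcos2 : cos (Real.pi * s / 2) ≠ 0 := fun h => hsin (by rw [hdouble, h, mul_zero])
  have hΓs : Gamma s = (s - 1) * Gamma (s - 1) := by
    rw [← Gamma_add_one _ hs1ne, sub_add_cancel]
  set K := Gamma (s - 1) * Gamma (2 - s) with hK
  -- The Laplace integral may blow up at 0 like Γ(s-1) x^(1-s); the difference `R` has a limit there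
  -- for every s in the strip other than 1.
  set R : ℝ → ℂ := fun x => Gamma (s - 1) * (x : ℂ) ^ (1 - s) -
    laplacePow (cauchyKernel 1) (s + 1) x with hR
  have hd1 : ∀ x, 0 < x → HasDerivAt R (-laplacePow (cauchyKernel 1) s x) x := by
    intro x hx
    have h1 := (hasDerivAt_ofReal_cpow_const hx.ne' (r := 1 - s)
      (fun h => hs1 (by linear_combination -h))).const_mul (Gamma (s - 1))
    refine (h1.sub (hasDerivAt_laplacePow hm hb hs1' hx)).congr_deriv ?_
    have h2 := laplacePow_cauchyKernel_add hs0 hx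
    rw [hΓs] at h2
    rw [show s + 1 + 1 = s + 2 by ring, show 1 - s - 1 = -s by ring]
    linear_combination h2
  have hd2 : ∀ x, 0 < x → HasDerivAt (fun x => -laplacePow (cauchyKernel 1) s x)
      (laplacePow (cauchyKernel 1) (s + 1) x) x := by
    intro x hx
    exact (hasDerivAt_laplacePow hm hb hs0 hx).neg.congr_deriv (by ring)
  have hsd : ∀ x : ℝ, HasDerivAt (fun x : ℝ => sin (x + Real.pi * s / 2))
      (cos (x + Real.pi * s / 2)) x := fun x => by
    have := ((hasDerivAt_id (x : ℂ)).add_const (Real.pi * s / 2)).csin.comp_ofReal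
    simpa using this
  have hcd : ∀ x : ℝ, HasDerivAt (fun x : ℝ => cos (x + Real.pi * s / 2))
      (-sin (x + Real.pi * s / 2)) x := fun x => by
    have := ((hasDerivAt_id (x : ℂ)).add_const (Real.pi * s / 2)).ccos.comp_ofReal
    simpa using this
  have hL0 : Tendsto (laplacePow (cauchyKernel 1) s) (𝓝[>] 0) (𝓝 (-K * cos (Real.pi * s / 2))) := by
    obtain ⟨hi, hv⟩ := laplacePow_cauchyKernel_zero 1 hs0 (by simpa)
    have h := tendsto_laplacePow_zero hm hi
    convert h using 2
    have h3 := Gamma_mul_Gamma_one_sub (s / 2)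
    rw [show (Real.pi : ℂ) * (s / 2) = Real.pi * s / 2 by ring] at h3
    simp only [Nat.cast_one, Gamma_one, mul_one, h3] at hv
    rw [hΓΓ, hdouble]
    have : laplacePow (cauchyKernel 1) s 0 = Real.pi / sin (Real.pi * s / 2) / 2 := by
      rw [← hv]; ring
    rw [this]
    field_simp
  have hN0 : Tendsto (laplacePow (cauchyKernel 2) (s + 1)) (𝓝[>] 0)
      (𝓝 ((s - 1) * K * sin (Real.pi * s / 2) / 2)) := by
    obtain ⟨hi, hv⟩ := laplacePow_cauchyKernel_zero 2 hs1' (by simp; linarith)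
    have h := tendsto_laplacePow_zero hm2 hi
    convert h using 2
    have h3 := Gamma_mul_Gamma_one_sub ((s + 1) / 2)
    have h4 : sin (Real.pi * ((s + 1) / 2)) = cos (Real.pi * s / 2) := by
      rw [show (Real.pi : ℂ) * ((s + 1) / 2) = Real.pi * s / 2 + Real.pi / 2 by ring,
        sin_add_pi_div_two]
    have h5 : Gamma (2 - (s + 1) / 2) = (1 - (s + 1) / 2) * Gamma (1 - (s + 1) / 2) := by
      rw [← Gamma_add_one]
      · congr 1; ring
      · intro h; exact hs1ne (by linear_combination -2 * h)
    have h6 : Gamma (2 : ℂ) = 1 := by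
      simp
    rw [h4] at h3
    push_cast at hv
    rw [h5, h6, mul_left_comm, h3] at hv
    rw [hΓΓ, hdouble]
    have : laplacePow (cauchyKernel 2) (s + 1) 0 =
        (1 - (s + 1) / 2) * (Real.pi / cos (Real.pi * s / 2)) / 2 := by
      rw [← hv]; ring
    rw [this]
    generalize sin (Real.pi * s / 2) = S at hsin2 ⊢
    generalize cos (Real.pi * s / 2) = C at hcos2 ⊢
    field_simp
    ring
  have hid0 : Tendsto (fun x : ℝ => (x : ℂ)) (𝓝[>] 0) (𝓝 0) := by
    simpa using (continuous_ofReal.tendsto 0).mono_left nhdsWithin_le_nhds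
  have hR0 : Tendsto R (𝓝[>] 0) (𝓝 (K * sin (Real.pi * s / 2))) := by
    -- Integration by parts gives (s - 1) R(x) = x L(s) + 2 N(s+1), with L and N the transforms for
    -- the kernels k = 1 and k = 2; both stay finite at 0.
    have h1 := ((hid0.mul hL0).add (hN0.const_mul 2)).div_const (s - 1)
    have e : ((0 : ℂ) * (-K * cos (Real.pi * s / 2)) +
        2 * ((s - 1) * K * sin (Real.pi * s / 2) / 2)) / (s - 1) = K * sin (Real.pi * s / 2) := by
      field_simp
      ring
    rw [e] at h1
    refine h1.congr' ?_
    filter_upwards [self_mem_nhdsWithin] with x hx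
    have hx0 : (0 : ℝ) < x := hx
    have hxc : (x : ℂ) ≠ 0 := ofReal_ne_zero.2 hx0.ne'
    have hp := laplacePow_cauchyKernel_parts hs0 hx0
    have h2 := laplacePow_cauchyKernel_add hs0 hx0
    rw [hΓs] at h2
    have h3 : (x : ℂ) ^ (1 - s) = x * (x : ℂ) ^ (-s) := by
      rw [sub_eq_add_neg, cpow_add _ _ hxc, cpow_one]
    rw [div_eq_iff hs1ne]
    simp only [hR, h3]
    linear_combination hp + x * h2
  have hsl : Tendsto (fun x : ℝ => sin (x + Real.pi * s / 2)) (𝓝[>] 0)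
      (𝓝 (sin (Real.pi * s / 2))) :=
    ((hsd 0).continuousAt.tendsto.mono_left nhdsWithin_le_nhds).trans (by simp)
  have hcl : Tendsto (fun x : ℝ => cos (x + Real.pi * s / 2)) (𝓝[>] 0)
      (𝓝 (cos (Real.pi * s / 2))) :=
    ((hcd 0).continuousAt.tendsto.mono_left nhdsWithin_le_nhds).trans (by simp)
  have key := eq_zero_of_hasDerivAt_neg
    (f := fun x => R x - K * (gammaSeries (2 - s) 2 x + sin (x + Real.pi * s / 2)))
    (f' := fun x => -laplacePow (cauchyKernel 1) s x -
      K * (gammaSeries (2 - s) 1 x + cos (x + Real.pi * s / 2)))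
    (fun x hx => (hd1 x hx).sub
      (((hasDerivAt_gammaSeries hc 1 hx).add (hsd x)).const_mul K))
    (fun x hx => ((hd2 x hx).sub
      (((hasDerivAt_gammaSeries hc 0 hx).add (hcd x)).const_mul K)).congr_deriv (by
        rw [gammaSeries_zero hc hx]
        simp only [hR, hK]
        rw [show 2 - s - 1 = 1 - s by ring]
        field_simp
        ring))
    (by simpa using hR0.sub (((tendsto_gammaSeries_zero hc 1).add hsl).const_mul K))
    (by simpa using hL0.neg.sub (((tendsto_gammaSeries_zero hc 0).add hcl).const_mul K)) hz
  rw [gammaSeries_zero hc hz]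
  have e : K * ((z : ℂ) ^ (2 - s - 1) / Gamma (2 - s)) = Gamma (s - 1) * (z : ℂ) ^ (1 - s) := by
    rw [hK, show 2 - s - 1 = 1 - s by ring]
    field_simp
  simp only [hR] at key
  linear_combination -key - e

/-! ### The Lommel function with ν = 1/2 as a Laplace integral -/

/-- By duplication, n! Γ(n + 1/2) is a multiple of (2n)!, so the Bessel series becomes the cosine
series. -/
lemma besselJ_neg_half {z : ℝ} (hz : 0 < z) :
    besselJ (-(1 / 2)) z = ((z / 2 : ℂ)) ^ (-(1 / 2) : ℂ) / (Real.sqrt Real.pi : ℂ) * cos z := by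
  have hz2 : (z / 2 : ℂ) ≠ 0 := by
    exact_mod_cast (by positivity : (0 : ℝ) < z / 2).ne'
  rw [besselJ, ← (hasSum_cos (z : ℂ)).tsum_eq, ← tsum_mul_left]
  refine tsum_congr fun n => ?_
  have h := Gamma_mul_Gamma_add_half ((n : ℂ) + 1 / 2)
  rw [show (n : ℂ) + 1 / 2 + 1 / 2 = n + 1 by ring, Gamma_nat_eq_factorial,
    show 2 * ((n : ℂ) + 1 / 2) = (2 * n : ℕ) + 1 by push_cast; ring, Gamma_nat_eq_factorial,
    show (1 : ℂ) - ((2 * n : ℕ) + 1) = -((2 * n : ℕ) : ℂ) by ring, cpow_neg, cpow_natCast] at h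
  have hf : ((n.factorial : ℕ) : ℂ) ≠ 0 := by exact_mod_cast n.factorial_ne_zero
  have hf2 : (((2 * n).factorial : ℕ) : ℂ) ≠ 0 := by exact_mod_cast (2 * n).factorial_ne_zero
  have hpi : (Real.sqrt Real.pi : ℂ) ≠ 0 := by
    exact_mod_cast (Real.sqrt_pos.2 Real.pi_pos).ne'
  rw [show -(1 / 2 : ℂ) + n + 1 = n + 1 / 2 by ring, mul_comm _ (Gamma _), h, cpow_add _ _ hz2,
    show 2 * (n : ℂ) = (2 * n : ℕ) by push_cast; ring, cpow_natCast, div_pow]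
  field_simp

lemma besselJ_half {z : ℝ} (hz : 0 < z) :
    besselJ (1 / 2) z = ((z / 2 : ℂ)) ^ (-(1 / 2) : ℂ) / (Real.sqrt Real.pi : ℂ) * sin z := by
  have hz2 : (z / 2 : ℂ) ≠ 0 := by
    exact_mod_cast (by positivity : (0 : ℝ) < z / 2).ne'
  rw [besselJ, ← (hasSum_sin (z : ℂ)).tsum_eq, ← tsum_mul_left]
  refine tsum_congr fun n => ?_
  have h := Gamma_mul_Gamma_add_half ((n : ℂ) + 1)
  rw [Gamma_nat_eq_factorial,
    show 2 * ((n : ℂ) + 1) = (2 * n + 1 : ℕ) + 1 by push_cast; ring, Gamma_nat_eq_factorial,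
    show (1 : ℂ) - ((2 * n + 1 : ℕ) + 1) = -((2 * n + 1 : ℕ) : ℂ) by ring, cpow_neg,
    cpow_natCast] at h
  have hf : ((n.factorial : ℕ) : ℂ) ≠ 0 := by exact_mod_cast n.factorial_ne_zero
  have hf2 : (((2 * n + 1).factorial : ℕ) : ℂ) ≠ 0 := by
    exact_mod_cast (2 * n + 1).factorial_ne_zero
  have hpi : (Real.sqrt Real.pi : ℂ) ≠ 0 := by
    exact_mod_cast (Real.sqrt_pos.2 Real.pi_pos).ne'
  rw [show (1 / 2 : ℂ) + n + 1 = n + 1 + 1 / 2 by ring, h,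
    show (1 / 2 : ℂ) + 2 * n = -(1 / 2) + (2 * n + 1 : ℕ) by push_cast; ring, cpow_add _ _ hz2,
    cpow_natCast, div_pow]
  field_simp

/-- The two lower parameters of ₁F₂ differ by 1/2, so duplication merges their Gamma factors into
Γ(2 - s + 2n); the upper parameter 1 cancels n!. -/
lemma lommelSmall_half {s : ℂ} (hs2 : s.re < 2) {z : ℝ} (hz : 0 < z) :
    lommelSmall (-s - 1 / 2) (1 / 2) z =
      (z : ℂ) ^ (-(1 / 2) : ℂ) * Gamma (2 - s) / (-s * (1 - s)) * gammaSeries (2 - s) 0 z := by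
  have hzc : (z : ℂ) ≠ 0 := ofReal_ne_zero.2 hz.ne'
  have hc : 0 < (2 - s).re := by simp; linarith
  have hpi : (Real.sqrt Real.pi : ℂ) ≠ 0 := by
    exact_mod_cast (Real.sqrt_pos.2 Real.pi_pos).ne'
  rw [lommelSmall, hypergeometric1F2, regularizedHGFun, FormalMultilinearSeries.sum]
  rw [show -s - 1 / 2 - 1 / 2 + 1 = -s by ring, show -s - 1 / 2 + 1 / 2 + 1 = 1 - s by ring,
    show (-s - 1 / 2) / 2 - 1 / 2 / 2 + 3 / 2 = (2 - s) / 2 by ring,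
    show (-s - 1 / 2) / 2 + 1 / 2 / 2 + 3 / 2 = (2 - s) / 2 + 1 / 2 by ring,
    Gamma_mul_Gamma_add_half, show 2 * ((2 - s) / 2) = 2 - s by ring, gammaSeries,
    ← tsum_mul_left, ← tsum_mul_left, ← tsum_mul_left]
  refine tsum_congr fun n => ?_
  have h := Gamma_mul_Gamma_add_half ((2 - s) / 2 + n)
  have h2 : (2 : ℂ) ^ (1 - 2 * ((2 - s) / 2 + n)) = 2 ^ (1 - (2 - s)) * (2 ^ (2 * n))⁻¹ := by
    rw [show 1 - 2 * ((2 - s) / 2 + n) = (1 - (2 - s)) + -((2 * n : ℕ) : ℂ) by push_cast; ring,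
      cpow_add _ _ two_ne_zero, cpow_neg, cpow_natCast]
  rw [h2, show 2 * ((2 - s) / 2 + (n : ℂ)) = 2 - s + (2 * n + 0 : ℕ) by push_cast; ring] at h
  have hG := Gamma_add_nat_ne_zero hc (2 * n + 0)
  have hf : ((n.factorial : ℕ) : ℂ) ≠ 0 := by exact_mod_cast n.factorial_ne_zero
  have h2c : (2 : ℂ) ^ (1 - (2 - s)) ≠ 0 := by simp [cpow_eq_zero_iff]
  simp only [regularizedHGFunSeries, FormalMultilinearSeries.ofScalars_apply_eq, smul_eq_mul,
    regularizedHGFunCoeff, Multiset.map_singleton, Multiset.prod_singleton,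
    Multiset.insert_eq_cons, Multiset.map_cons, Multiset.prod_cons, ascPochhammer_eval_one]
  have e2 : (z : ℂ) ^ (2 - s + ((2 * n + 0 : ℕ) : ℂ) - 1) =
      (z : ℂ) ^ (-s - 1 / 2 + 1) * (z : ℂ) ^ (1 / 2 : ℂ) * (z : ℂ) ^ (2 * n) := by
    rw [← cpow_natCast, ← cpow_add _ _ hzc, ← cpow_add _ _ hzc]
    congr 1
    push_cast
    ring
  rw [show (2 - s) / 2 + 1 / 2 + (n : ℂ) = (2 - s) / 2 + n + 1 / 2 by ring, h, gammaMonomial, e2,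
    cpow_neg]
  have hz12 : (z : ℂ) ^ (1 / 2 : ℂ) ≠ 0 := by simp [cpow_eq_zero_iff, hzc]
  have e : (-(z : ℂ) ^ 2 / 4) ^ n = (-1) ^ n * (z : ℂ) ^ (2 * n) * (2 ^ (2 * n))⁻¹ := by
    rw [pow_mul, pow_mul, ← mul_pow, ← inv_pow, ← mul_pow]
    congr 1
    norm_num
    ring
  rw [e]
  generalize (z : ℂ) ^ (-s - 1 / 2 + 1) = W
  field_simp

/-- The Bessel terms combine into a multiple of sin(z + πs/2), so the closed formula is the series
expression of `laplacePow_cauchyKernel_eq_series`. -/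
lemma lommelFormula_half {s : ℂ} (hs0 : 0 < s.re) (hs2 : s.re < 2) (hs1 : s ≠ 1) {z : ℝ}
    (hz : 0 < z) :
    lommelFormula (-s - 1 / 2) (1 / 2) z =
      (z : ℂ) ^ (-(1 / 2) : ℂ) / Gamma (s + 1) * laplacePow (cauchyKernel 1) (s + 1) z := by
  have hs0' : s ≠ 0 := fun h => by rw [h] at hs0; simp at hs0
  have hs1' : s - 1 ≠ 0 := sub_ne_zero.2 hs1
  have hs1'' : 1 - s ≠ 0 := sub_ne_zero.2 hs1.symm
  have hzc : (z : ℂ) ≠ 0 := ofReal_ne_zero.2 hz.ne'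
  have hpi : (Real.sqrt Real.pi : ℂ) ≠ 0 := by
    exact_mod_cast (Real.sqrt_pos.2 Real.pi_pos).ne'
  have hΓ : Gamma (s - 1) ≠ 0 := Gamma_ne_zero (sub_one_ne_neg_nat hs0 hs1)
  have hΓ1 : Gamma (s + 1) = s * ((s - 1) * Gamma (s - 1)) := by
    rw [Gamma_add_one _ hs0', ← Gamma_add_one _ hs1', sub_add_cancel]
  have hΓ2 : Gamma (2 - s) = (1 - s) * (-s * Gamma (-s)) := by
    rw [← Gamma_add_one _ (neg_ne_zero.2 hs0'), show -s + 1 = 1 - s by ring,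
      ← Gamma_add_one _ hs1'']
    congr 1; ring
  rw [laplacePow_cauchyKernel_eq_series hs0 hs2 hs1 hz, lommelFormula, lommelSmall_half hs2 hz,
    besselJ_neg_half hz, besselJ_half hz,
    show (-s - 1 / 2 - 1 / 2 + 1) / 2 = -s / 2 by ring,
    show (-s - 1 / 2 + 1 / 2 + 1) / 2 = -s / 2 + 1 / 2 by ring,
    show (-s - 1 / 2 - 1 / 2) * (Real.pi : ℂ) / 2 = -(Real.pi * s / 2 + Real.pi / 2) by ring,
    show (-s - 1 / 2 + 1 / 2) * (Real.pi : ℂ) / 2 = -(Real.pi * s / 2) by ring,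
    show (1 / 2 : ℂ) * Real.pi = Real.pi / 2 by ring, sin_pi_div_two, cos_neg, cos_neg,
    cos_add_pi_div_two, mul_assoc (2 ^ _) (Gamma _) (Gamma _), Gamma_mul_Gamma_add_half,
    show 2 * (-s / 2) = -s by ring, sin_add]
  -- The powers of 2 multiply to 2^(-1/2), which joins (z/2)^(-1/2) to form z^(-1/2).
  have e1 : (2 : ℂ) ^ (-s - 1 / 2 - 1) * 2 ^ (1 - -s) * ((z : ℂ) / 2) ^ (-(1 / 2) : ℂ) =
      (z : ℂ) ^ (-(1 / 2) : ℂ) := by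
    have := mul_cpow_ofReal_nonneg (a := 2) (b := z / 2) (by norm_num) (by positivity)
      (-(1 / 2) : ℂ)
    push_cast at this
    rw [← cpow_add _ _ two_ne_zero, show -s - 1 / 2 - 1 + (1 - -s) = (-(1 / 2) : ℂ) by ring, ← this,
      mul_div_cancel₀ _ two_ne_zero]
  rw [← e1, hΓ1, hΓ2]
  field_simp
  ring

/-- The value of the Lommel function `S_{-s-1/2, 1/2}(z)` as a Laplace integral. -/
def lommelIntegral (s : ℂ) (z : ℝ) : ℂ :=
  (z : ℂ) ^ (-(1 / 2) : ℂ) / Gamma (s + 1) * laplacePow (cauchyKernel 1) (s + 1) z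

lemma continuousAt_lommelIntegral {s : ℂ} (hs0 : 0 < s.re) {z : ℝ} (hz : 0 < z) :
    ContinuousAt (fun s => lommelIntegral s z) s := by
  have hs1 : 0 < (s + 1).re := by simp; linarith
  have hΓ : ContinuousAt (fun s => Gamma (s + 1)) s :=
    (differentiableAt_Gamma (s + 1) (fun m h => by
      rw [h] at hs1; simp at hs1
      have : (0 : ℝ) ≤ m := by positivity
      linarith)).continuousAt.comp (f := fun s : ℂ => s + 1) (by fun_prop)
  have hL : DifferentiableAt ℂ (fun w => laplacePow (cauchyKernel 1) w z) (s + 1) := by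
    have hcont : Continuous fun x : ℝ => ((cauchyKernel 1 x * Real.exp (-z * x) : ℝ) : ℂ) :=
      continuous_ofReal.comp ((continuous_cauchyKernel 1).mul (by fun_prop))
    refine mellin_differentiableAt_of_isBigO_rpow_exp (a := z) (b := 0) hz
      (f := fun x : ℝ => ((cauchyKernel 1 x * Real.exp (-z * x) : ℝ) : ℂ))
      (hcont.locallyIntegrable.locallyIntegrableOn _) ?_ ?_ hs1
    · refine Asymptotics.IsBigO.of_bound 1 (Eventually.of_forall fun x => ?_)
      rw [norm_real, norm_mul, one_mul]
      exact mul_le_of_le_one_left (norm_nonneg _) (abs_cauchyKernel_le_one 1 x)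
    · simp only [neg_zero, Real.rpow_zero]
      exact (hcont.tendsto 0 |>.mono_left nhdsWithin_le_nhds).isBigO_one ℝ
  exact (continuousAt_const.div hΓ (Gamma_ne_zero_of_re_pos hs1)).mul
    (hL.continuousAt.comp (f := fun s : ℂ => s + 1) (by fun_prop))

lemma isExceptional_half_iff {s : ℂ} (hs0 : 0 < s.re) (hs2 : s.re < 2) :
    IsExceptional (-s - 1 / 2) (1 / 2) ↔ s = 1 := by
  constructor
  · rintro ⟨k, h | h⟩
    · have h' : s = 2 * k := by linear_combination -h
      rw [h'] at hs0 hs2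
      simp at hs0 hs2
      have : k < 1 := by exact_mod_cast (by linarith : (k : ℝ) < 1)
      omega
    · have h' : s = 2 * k + 1 := by linear_combination -h
      rw [h'] at hs0 hs2
      simp at hs0 hs2
      have : k < 1 := by exact_mod_cast (by linarith : (k : ℝ) < 1)
      obtain rfl : k = 0 := by omega
      simpa using h'
  · rintro rfl
    exact ⟨0, Or.inr (by norm_num)⟩

lemma continuousAt_lommelIntegral_comp {s : ℂ} (hs0 : 0 < s.re) {z : ℝ} (hz : 0 < z) :
    ContinuousAt (fun μ : ℂ => lommelIntegral (-μ - 1 / 2) z) (-s - 1 / 2) :=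
  ContinuousAt.comp (f := fun μ : ℂ => -μ - 1 / 2) (g := fun s => lommelIntegral s z)
    (by rw [show -(-s - 1 / 2) - 1 / 2 = s by ring]; exact continuousAt_lommelIntegral hs0 hz)
    (by fun_prop)

lemma eventually_neg_sub_half_mem_strip {s : ℂ} (hs0 : 0 < s.re) (hs2 : s.re < 2) :
    ∀ᶠ μ in 𝓝 (-s - 1 / 2), 0 < (-μ - 1 / 2).re ∧ (-μ - 1 / 2).re < 2 := by
  have hcont : Continuous fun μ : ℂ => (-μ - 1 / 2).re := by fun_prop
  refine (isOpen_Ioo.preimage hcont).mem_nhds ?_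
  rw [mem_preimage, show -(-s - 1 / 2) - 1 / 2 = s by ring]
  exact ⟨hs0, hs2⟩

/-- At s = 1, the only exceptional point of the strip, the closed formula agrees with the continuous
Laplace integral on a punctured neighbourhood, which determines the limit. -/
lemma lommelS_half {s : ℂ} (hs0 : 0 < s.re) (hs2 : s.re < 2) {z : ℝ} (hz : 0 < z) :
    lommelS (-s - 1 / 2) (1 / 2) z = lommelIntegral s z := by
  rw [lommelS]
  by_cases hs1 : s = 1
  · rw [if_pos ((isExceptional_half_iff hs0 hs2).2 hs1)]
    refine Tendsto.limUnder_eq ?_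
    have hc := continuousAt_lommelIntegral_comp hs0 hz
    have ht := hc.tendsto.mono_left (nhdsWithin_le_nhds (s := {-s - 1 / 2}ᶜ))
    rw [show -(-s - 1 / 2) - 1 / 2 = s by ring] at ht
    refine ht.congr' ?_
    filter_upwards [nhdsWithin_le_nhds (eventually_neg_sub_half_mem_strip hs0 hs2),
      self_mem_nhdsWithin] with μ ⟨hμ0, hμ2⟩ hμ1
    have := lommelFormula_half hμ0 hμ2 (fun h => hμ1 (by
      rw [mem_singleton_iff, hs1]; linear_combination -h)) hz
    rw [show -(-μ - 1 / 2) - 1 / 2 = μ by ring] at this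
    rw [this, lommelIntegral]
  · rw [if_neg (fun h => hs1 ((isExceptional_half_iff hs0 hs2).1 h)),
      lommelFormula_half hs0 hs2 hs1 hz, lommelIntegral]

lemma continuousAt_lommelS_half {s : ℂ} (hs0 : 0 < s.re) (hs2 : s.re < 2) {z : ℝ} (hz : 0 < z) :
    ContinuousAt (fun μ : ℂ => lommelS μ (1 / 2) z) (-s - 1 / 2) := by
  have hc := continuousAt_lommelIntegral_comp hs0 hz
  refine hc.congr ?_
  filter_upwards [eventually_neg_sub_half_mem_strip hs0 hs2] with μ ⟨hμ0, hμ2⟩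
  rw [← lommelS_half hμ0 hμ2 hz, show -(-μ - 1 / 2) - 1 / 2 = μ by ring]

/-! ### The kernel 1/(e^t - 1): expansions, bounds and Mellin transform -/

/-- The Bose–Einstein kernel `1 / (e ^ t - 1)`. -/
def bose (t : ℝ) : ℝ := (Real.exp t - 1)⁻¹

/-- The odd function `1 / (e ^ t - 1) + 1 / 2 - 1 / t`. -/
def oddBose (t : ℝ) : ℝ := bose t + 1 / 2 - 1 / t

lemma bose_denom_pos {t : ℝ} (ht : 0 < t) : 0 < Real.exp t - 1 := by
  linarith [Real.add_one_lt_exp ht.ne']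

lemma bose_pos {t : ℝ} (ht : 0 < t) : 0 < bose t := inv_pos.2 (bose_denom_pos ht)

lemma bose_le_inv {t : ℝ} (ht : 0 < t) : bose t ≤ t⁻¹ :=
  inv_anti₀ ht (by linarith [Real.add_one_le_exp t])

lemma continuousOn_bose : ContinuousOn bose (Ioi 0) :=
  ContinuousOn.inv₀ (by fun_prop) fun _ ht => (bose_denom_pos ht).ne'

lemma hasSum_bose {t : ℝ} (ht : 0 < t) :
    HasSum (fun n : ℕ => Real.exp (-((n : ℝ) + 1) * t)) (bose t) := by
  have h1 : Real.exp (-t) < 1 := Real.exp_lt_one_iff.2 (by linarith)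
  have h := (hasSum_geometric_of_lt_one (Real.exp_pos (-t)).le h1).mul_left (Real.exp (-t))
  have e1 : ∀ n : ℕ, Real.exp (-t) * Real.exp (-t) ^ n = Real.exp (-((n : ℝ) + 1) * t) := by
    intro n
    rw [← Real.exp_nat_mul, ← Real.exp_add]
    congr 1; ring
  have e2 : Real.exp (-t) * (1 - Real.exp (-t))⁻¹ = bose t := by
    have := bose_denom_pos ht
    have := Real.exp_pos t
    have e3 : 1 - (Real.exp t)⁻¹ = (Real.exp t - 1) / Real.exp t := by field_simp
    rw [bose, Real.exp_neg, e3]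
    field_simp
  simpa only [e1, e2] using h

lemma summable_pnat_inv_sq : Summable fun n : ℕ+ => ((n : ℝ) ^ 2)⁻¹ :=
  (Real.summable_nat_pow_inv.2 one_lt_two).comp_injective PNat.coe_injective

lemma pole_term_le {t : ℝ} (ht : 0 < t) (n : ℕ+) :
    2 * t / (t ^ 2 + 4 * Real.pi ^ 2 * n ^ 2) ≤ t * ((n : ℝ) ^ 2)⁻¹ := by
  have hn : (0 : ℝ) < n := by exact_mod_cast n.pos
  have hpi := Real.pi_gt_three
  rw [← div_eq_mul_inv, div_le_div_iff₀ (by positivity) (by positivity)]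
  have : (n : ℝ) ^ 2 * 2 ≤ t ^ 2 + 4 * Real.pi ^ 2 * n ^ 2 := by
    have h9 : (9 : ℝ) ≤ Real.pi ^ 2 := by nlinarith
    nlinarith [sq_nonneg t, sq_nonneg (n : ℝ)]
  nlinarith

/-- This is the partial fraction series of π cot(πx) at x = it/(2π). -/
lemma hasSum_oddBose {t : ℝ} (ht : 0 < t) :
    HasSum (fun n : ℕ+ => 2 * t / (t ^ 2 + 4 * Real.pi ^ 2 * n ^ 2)) (oddBose t) := by
  have hsum : Summable fun n : ℕ+ => 2 * t / (t ^ 2 + 4 * Real.pi ^ 2 * n ^ 2) :=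
    Summable.of_nonneg_of_le (fun n => by positivity) (pole_term_le ht)
      (summable_pnat_inv_sq.mul_left t)
  rw [hsum.hasSum_iff]
  set x : ℂ := I * t / (2 * Real.pi) with hx
  have hpi : (Real.pi : ℂ) ≠ 0 := ofReal_ne_zero.2 Real.pi_ne_zero
  have htc : (t : ℂ) ≠ 0 := ofReal_ne_zero.2 ht.ne'
  have hxim : x.im = t / (2 * Real.pi) := by
    rw [hx, show I * (t : ℂ) / (2 * Real.pi) = I * ((t / (2 * Real.pi) : ℝ) : ℂ) by
      push_cast; ring, I_mul_im, ofReal_re]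
  have hxmem : x ∈ integerComplement := by
    rintro ⟨n, hn⟩
    have := congrArg im hn
    rw [hxim] at this
    rw [intCast_im] at this
    exact absurd this (by have := Real.pi_pos; positivity)
  have h := cot_series_rep hxmem
  have e1 : ∀ n : ℕ+, 1 / (x - n) + 1 / (x + n) =
      (-2 * Real.pi * I) * ((2 * t / (t ^ 2 + 4 * Real.pi ^ 2 * n ^ 2) : ℝ) : ℂ) := by
    intro n
    have h1 : x - n ≠ 0 := fun h => hxmem ⟨n, by push_cast; linear_combination -h⟩
    have h2 : x + n ≠ 0 := fun h => hxmem ⟨-n, by push_cast; linear_combination -h⟩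
    have h3 : ((t : ℂ) ^ 2 + 4 * Real.pi ^ 2 * n ^ 2) ≠ 0 := by
      have hn : (0 : ℝ) < n := by exact_mod_cast n.pos
      exact_mod_cast (by positivity : (0 : ℝ) < t ^ 2 + 4 * Real.pi ^ 2 * n ^ 2).ne'
    have h4 : (x - n) * (x + n) = -((t : ℂ) ^ 2 + 4 * Real.pi ^ 2 * n ^ 2) / (4 * Real.pi ^ 2) := by
      rw [hx]
      field_simp
      ring_nf
      rw [I_sq]
      ring_nf
    rw [div_add_div _ _ h1 h2, h4]
    push_cast
    rw [hx]
    field_simp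
    ring
  simp_rw [e1] at h
  rw [tsum_mul_left, ← ofReal_tsum, cot_eq_exp_ratio,
    show 2 * I * (Real.pi * x) = -(t : ℂ) by rw [hx]; field_simp; rw [I_sq]] at h
  have hexp : cexp t - 1 ≠ 0 := by
    have := (bose_denom_pos ht).ne'
    exact_mod_cast this
  have hexp0 := exp_ne_zero (t : ℂ)
  have hexp' : 1 - cexp (-t) ≠ 0 := by
    rw [exp_neg]
    intro h0
    apply hexp
    field_simp at h0
    simpa using h0
  have goal : ((∑' n : ℕ+, 2 * t / (t ^ 2 + 4 * Real.pi ^ 2 * n ^ 2) : ℝ) : ℂ) =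
      (oddBose t : ℂ) := by
    have h5 : (cexp (-t) + 1) / (I * (1 - cexp (-t))) = -I * (1 + 2 * (cexp t - 1)⁻¹) := by
      rw [exp_neg] at hexp' ⊢
      rw [div_eq_iff (mul_ne_zero I_ne_zero hexp')]
      field_simp
      rw [I_sq]
      ring
    have h6 : 1 / x = -2 * Real.pi * I / t := by
      rw [hx]
      field_simp
      rw [I_sq, neg_neg]
    rw [h5, h6] at h
    have h7 : (-2 * Real.pi * I : ℂ) ≠ 0 :=
      mul_ne_zero (mul_ne_zero (by norm_num) hpi) I_ne_zero
    apply mul_left_cancel₀ h7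
    rw [oddBose, bose]
    push_cast at h ⊢
    linear_combination -h
  exact_mod_cast goal

/-- An upper bound for `oddBose t / t`. -/
def oddBoseSlope : ℝ := ∑' n : ℕ+, ((n : ℝ) ^ 2)⁻¹

lemma oddBose_nonneg {t : ℝ} (ht : 0 < t) : 0 ≤ oddBose t :=
  (hasSum_oddBose ht).nonneg fun n => by positivity

/-- The linear bound keeps `oddBose t / (a * t)`, hence `zetaKernel`, bounded near 0. -/
lemma oddBose_le {t : ℝ} (ht : 0 < t) : oddBose t ≤ t * oddBoseSlope :=
  hasSum_le (pole_term_le ht) (hasSum_oddBose ht) (summable_pnat_inv_sq.hasSum.mul_left t)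

/-- The function `1 / (e ^ t - 1) - 1 / t`. -/
def boseDiff (t : ℝ) : ℝ := bose t - 1 / t

/-- This bound near 0 and the bound 1/t at infinity make the Mellin transform of a product of two
such factors converge for 0 < Re s < 2. -/
lemma abs_boseDiff_le_half {t : ℝ} (ht : 0 < t) : |boseDiff t| ≤ 1 / 2 := by
  have h1 := oddBose_nonneg ht
  have h2 := bose_le_inv ht
  rw [oddBose] at h1
  rw [boseDiff, abs_le]
  constructor
  · linarith
  · rw [one_div]; linarith

lemma abs_boseDiff_le_inv {t : ℝ} (ht : 0 < t) : |boseDiff t| ≤ 1 / t := by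
  have h2 := bose_le_inv ht
  have h3 := bose_pos ht
  have : 0 < 1 / t := by positivity
  rw [boseDiff, abs_le]
  constructor
  · linarith
  · rw [one_div] at *; linarith

lemma bose_isBigO (r : ℝ) : bose =O[atTop] fun t : ℝ => t ^ (-r) := by
  have h1 : bose =O[atTop] fun t : ℝ => Real.exp (-1 * t) := by
    refine Asymptotics.IsBigO.of_bound 2 ?_
    filter_upwards [eventually_ge_atTop 1] with t ht
    have h0 : 0 < t := by linarith
    rw [Real.norm_of_nonneg (bose_pos h0).le, Real.norm_of_nonneg (Real.exp_pos _).le, bose,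
      neg_one_mul, Real.exp_neg, inv_le_iff_one_le_mul₀ (bose_denom_pos h0)]
    have := Real.add_one_le_exp t
    have h2 : 2 * (Real.exp t)⁻¹ * (Real.exp t - 1) = 2 - 2 * (Real.exp t)⁻¹ := by
      field_simp
    have h3 : (Real.exp t)⁻¹ ≤ 1 / 2 := by
      rw [one_div]; exact inv_anti₀ two_pos (by linarith)
    linarith
  exact h1.trans (isLittleO_exp_neg_mul_rpow_atTop one_pos _).isBigO

lemma mellin_bose {s : ℂ} (hs : 1 < s.re) :
    HasMellin (fun t => (bose t : ℂ)) s (Gamma s * riemannZeta s) := by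
  constructor
  · refine mellinConvergent_of_isBigO_rpow (a := s.re + 1) (b := 1)
      ((continuous_ofReal.comp_continuousOn continuousOn_bose).locallyIntegrableOn
        measurableSet_Ioi) ?_ (by linarith) ?_ hs
    · exact isBigO_ofReal_left.2 (bose_isBigO (s.re + 1))
    · refine Asymptotics.IsBigO.of_bound 1 ?_
      filter_upwards [self_mem_nhdsWithin] with t ht
      have ht0 : (0 : ℝ) < t := ht
      rw [norm_real, Real.norm_of_nonneg (bose_pos ht).le, Real.rpow_neg_one, one_mul,
        Real.norm_of_nonneg (inv_pos.2 ht0).le]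
      exact bose_le_inv ht
  · have h := hasSum_mellin (a := fun _ : ℕ => (1 : ℂ)) (p := fun n : ℕ => (n : ℝ) + 1)
      (F := fun t => (bose t : ℂ)) (s := s) (fun i => Or.inr (by positivity)) (by linarith)
      (fun t ht => by
        simp only [one_mul]
        exact_mod_cast (hasSum_bose ht)) (by
        simp only [norm_one]
        have := (Real.summable_one_div_nat_rpow.2 hs).comp_injective (Nat.succ_injective)
        refine this.congr fun n => ?_
        simp)
    rw [zeta_eq_tsum_one_div_nat_add_one_cpow hs, ← h.tsum_eq, ← tsum_mul_left]
    refine tsum_congr fun n => ?_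
    push_cast
    ring

/-! ### The zeta terms as a Mellin transform on the strip -/

/-- The kernel whose Mellin transform is `Γ(s)` times `zetaFormula`. -/
def zetaKernel (a t : ℝ) : ℝ := boseDiff (a * t) / 2 + oddBose t / (a * t)

/-- The rapidly decreasing part of `zetaKernel`. -/
def zetaKernelMain (a t : ℝ) : ℝ := bose (a * t) / 2 + bose t / (a * t)

/-- The 1/t singularities of the two parts of `zetaKernelMain` cancel at 0, leaving t^(-2)/a.
Removing that term moves the strip of convergence from Re s > 2 to 0 < Re s < 2. -/
lemma zetaKernel_eq {a t : ℝ} (ha : 0 < a) (ht : 0 < t) :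
    zetaKernel a t = zetaKernelMain a t - 1 / a * (t ^ 2)⁻¹ := by
  rw [zetaKernel, zetaKernelMain, boseDiff, oddBose]
  field_simp
  ring

lemma continuousOn_bose_mul {a : ℝ} (ha : 0 < a) :
    ContinuousOn (fun t => bose (a * t)) (Ioi 0) :=
  continuousOn_bose.comp (by fun_prop) fun _ ht => mul_pos ha ht

lemma continuousOn_zetaKernelMain {a : ℝ} (ha : 0 < a) :
    ContinuousOn (zetaKernelMain a) (Ioi 0) :=
  ((continuousOn_bose_mul ha).div_const 2).add
    (continuousOn_bose.div (by fun_prop) fun _ ht => (mul_pos ha ht).ne')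

lemma continuousOn_boseDiff : ContinuousOn boseDiff (Ioi 0) :=
  continuousOn_bose.sub (continuousOn_const.div continuousOn_id fun _ ht => ne_of_gt ht)

lemma continuousOn_boseDiff_mul {a : ℝ} (ha : 0 < a) :
    ContinuousOn (fun t => boseDiff (a * t)) (Ioi 0) :=
  continuousOn_boseDiff.comp (by fun_prop) fun _ ht => mul_pos ha ht

lemma continuousOn_oddBose : ContinuousOn oddBose (Ioi 0) :=
  (continuousOn_bose.add continuousOn_const).sub
    (continuousOn_const.div continuousOn_id fun _ ht => ne_of_gt ht)

lemma continuousOn_zetaKernel {a : ℝ} (ha : 0 < a) : ContinuousOn (zetaKernel a) (Ioi 0) :=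
  ((continuousOn_boseDiff_mul ha).div_const 2).add
    (continuousOn_oddBose.div (by fun_prop) fun _ ht => (mul_pos ha ht).ne')

lemma locallyIntegrableOn_ofReal {f : ℝ → ℝ} (hf : ContinuousOn f (Ioi 0)) :
    LocallyIntegrableOn (fun t => (f t : ℂ)) (Ioi 0) :=
  (continuous_ofReal.comp_continuousOn hf).locallyIntegrableOn measurableSet_Ioi

lemma abs_zetaKernel_le {a t : ℝ} (ha : 0 < a) (ht : 0 < t) :
    |zetaKernel a t| ≤ 1 / 4 + oddBoseSlope / a := by
  have h1 := abs_boseDiff_le_half (mul_pos ha ht)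
  have h2 := oddBose_nonneg ht
  have h3 := oddBose_le ht
  have h4 : |oddBose t / (a * t)| ≤ oddBoseSlope / a := by
    rw [abs_of_nonneg (by positivity), div_le_div_iff₀ (by positivity) ha]
    nlinarith
  rw [zetaKernel]
  refine (abs_add_le _ _).trans (add_le_add ?_ h4)
  rw [abs_div, abs_two]
  linarith

lemma isBigO_zero_zetaKernel {a : ℝ} (ha : 0 < a) :
    (fun t => (zetaKernel a t : ℂ)) =O[𝓝[>] 0] fun t : ℝ => t ^ (-(0 : ℝ)) := by
  refine Asymptotics.IsBigO.of_bound (1 / 4 + oddBoseSlope / a) ?_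
  filter_upwards [self_mem_nhdsWithin] with t ht
  simpa using abs_zetaKernel_le ha ht

lemma isBigO_top_zetaKernelMain {a : ℝ} (ha : 0 < a) (r : ℝ) :
    zetaKernelMain a =O[atTop] fun t : ℝ => t ^ (-r) := by
  have h1 : (fun t => bose (a * t)) =O[atTop] fun t : ℝ => t ^ (-r) := by
    have h := (bose_isBigO r).comp_tendsto (tendsto_id.const_mul_atTop ha)
    refine h.trans (Asymptotics.IsBigO.of_bound (a ^ (-r)) ?_)
    filter_upwards [eventually_gt_atTop 0] with t ht
    simp only [Function.comp, id]
    rw [Real.mul_rpow ha.le ht.le, norm_mul, Real.norm_of_nonneg (Real.rpow_nonneg ha.le _)]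
  have h2 : (fun t => bose t / (a * t)) =O[atTop] fun t : ℝ => t ^ (-r) := by
    refine Asymptotics.IsBigO.trans (Asymptotics.IsBigO.of_bound (1 / a) ?_) (bose_isBigO r)
    filter_upwards [eventually_ge_atTop 1] with t ht
    rw [norm_div, Real.norm_of_nonneg (by positivity : 0 ≤ a * t), div_le_iff₀ (by positivity)]
    have : 1 / a * ‖bose t‖ * (a * t) = ‖bose t‖ * t := by field_simp
    rw [this]
    exact le_mul_of_one_le_right (norm_nonneg _) ht
  exact (h1.const_mul_left (1 / 2)).add h2 |>.congr_left fun t => by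
    simp only [zetaKernelMain]; ring

lemma isBigO_top_zetaKernel {a : ℝ} (ha : 0 < a) :
    (fun t => (zetaKernel a t : ℂ)) =O[atTop] fun t : ℝ => t ^ (-(2 : ℝ)) := by
  rw [isBigO_ofReal_left]
  have h2 : (fun t : ℝ => 1 / a * (t ^ 2)⁻¹) =O[atTop] fun t : ℝ => t ^ (-(2 : ℝ)) := by
    refine Asymptotics.IsBigO.const_mul_left ?_ _
    refine (Asymptotics.isBigO_refl _ _).congr' ?_ EventuallyEq.rfl
    filter_upwards [eventually_ge_atTop 0] with t ht
    rw [Real.rpow_neg ht, Real.rpow_ofNat]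
  refine ((isBigO_top_zetaKernelMain ha 2).sub h2).congr' ?_ EventuallyEq.rfl
  filter_upwards [eventually_gt_atTop 0] with t ht
  rw [zetaKernel_eq ha ht]

lemma mellinConvergent_zetaKernel {a : ℝ} (ha : 0 < a) {s : ℂ} (hs0 : 0 < s.re) (hs2 : s.re < 2) :
    MellinConvergent (fun t => (zetaKernel a t : ℂ)) s :=
  mellinConvergent_of_isBigO_rpow (locallyIntegrableOn_ofReal (continuousOn_zetaKernel ha))
    (isBigO_top_zetaKernel ha) hs2 (isBigO_zero_zetaKernel ha) hs0

lemma differentiableAt_mellin_zetaKernel {a : ℝ} (ha : 0 < a) {s : ℂ} (hs0 : 0 < s.re)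
    (hs2 : s.re < 2) : DifferentiableAt ℂ (mellin fun t => (zetaKernel a t : ℂ)) s :=
  mellin_differentiableAt_of_isBigO_rpow
    (locallyIntegrableOn_ofReal (continuousOn_zetaKernel ha))
    (isBigO_top_zetaKernel ha) hs2 (isBigO_zero_zetaKernel ha) hs0

lemma hasMellin_zetaKernelMain {a : ℝ} (ha : 0 < a) {s : ℂ} (hs : 2 < s.re) :
    HasMellin (fun t => (zetaKernelMain a t : ℂ)) s (Gamma s * zetaFormula a s) := by
  have h1 := mellin_bose (s := s) (by linarith)
  have h2 := mellin_bose (s := s - 1) (by simp; linarith)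
  have c1 : MellinConvergent (fun t => (bose (a * t) : ℂ)) s :=
    (MellinConvergent.comp_mul_left (f := fun t => (bose t : ℂ)) ha).2 h1.1
  have m1 := mellin_comp_mul_left (fun t => (bose t : ℂ)) s ha
  have c2 : MellinConvergent (fun t => (t : ℂ) ^ (-1 : ℂ) • (bose t : ℂ)) s :=
    MellinConvergent.cpow_smul.2 (by simpa [sub_eq_add_neg] using h2.1)
  have m2 := mellin_cpow_smul (fun t => (bose t : ℂ)) s (-1)
  have h := hasMellin_add (c1.const_smul (1 / 2 : ℂ)) (c2.const_smul (1 / a : ℂ))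
  rw [mellin_const_smul, mellin_const_smul, m1, m2, h1.2, ← sub_eq_add_neg, h2.2] at h
  have hs1 : s - 1 ≠ 0 := fun h0 => by
    have := congrArg re h0
    simp at this
    linarith
  have e : (1 / 2 : ℂ) • (a : ℂ) ^ (-s) • (Gamma s * riemannZeta s) +
      (1 / a : ℂ) • (Gamma (s - 1) * riemannZeta (s - 1)) = Gamma s * zetaFormula a s := by
    have hΓ : Gamma s = (s - 1) * Gamma (s - 1) := by
      rw [← Gamma_add_one _ hs1, sub_add_cancel]
    have hac : (a : ℂ) ≠ 0 := ofReal_ne_zero.2 ha.ne'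
    have has : (a : ℂ) ^ s ≠ 0 := by simp [cpow_eq_zero_iff, hac]
    simp only [smul_eq_mul, zetaFormula, cpow_neg, hΓ]
    field_simp
  rw [e] at h
  have e2 : (fun t => (zetaKernelMain a t : ℂ)) =
      fun t : ℝ => (1 / 2 : ℂ) • (bose (a * t) : ℂ) +
        (1 / a : ℂ) • ((t : ℂ) ^ (-1 : ℂ) • (bose t : ℂ)) := by
    ext t
    simp only [zetaKernelMain, smul_eq_mul, cpow_neg_one]
    push_cast
    rw [div_eq_mul_inv _ ((a : ℂ) * t), mul_inv]
    ring
  rw [e2]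
  exact h

/-- `zetaKernelMain` with its singularity at `0` removed on `(0, 1]`. -/
def zetaKernelCut (a t : ℝ) : ℂ :=
  zetaKernelMain a t - (1 / a : ℂ) • indicator (Ioc 0 1) (fun t : ℝ => (t : ℂ) ^ (-2 : ℂ)) t

lemma hasMellin_zetaKernelCut {a : ℝ} (ha : 0 < a) {s : ℂ} (hs : 2 < s.re) :
    HasMellin (zetaKernelCut a) s (Gamma s * zetaFormula a s - 1 / (a * (s - 2))) := by
  have h1 := hasMellin_zetaKernelMain ha hs
  have h2 := hasMellin_cpow_Ioc (-2) (s := s) (by simp; linarith)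
  have h := hasMellin_sub h1.1 (h2.1.const_smul (1 / a : ℂ))
  rw [mellin_const_smul, h1.2, h2.2, smul_eq_mul, ← sub_eq_add_neg, div_mul_div_comm, one_mul] at h
  exact h

lemma differentiableAt_mellin_zetaKernelCut {a : ℝ} (ha : 0 < a) {s : ℂ} (hs : 0 < s.re) :
    DifferentiableAt ℂ (mellin (zetaKernelCut a)) s := by
  refine mellin_differentiableAt_of_isBigO_rpow (a := s.re + 1) (b := 0) ?_ ?_ (by linarith) ?_ hs
  · refine (locallyIntegrableOn_ofReal (continuousOn_zetaKernelMain ha)).sub ?_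
    have h3 : LocallyIntegrableOn (fun t : ℝ => (t : ℂ) ^ (-2 : ℂ)) (Ioi 0) := by
      refine ContinuousOn.locallyIntegrableOn (fun t ht => ?_) measurableSet_Ioi
      exact (continuousAt_ofReal_cpow_const _ _ (Or.inr (ne_of_gt ht))).continuousWithinAt
    intro x hx
    obtain ⟨U, hU, hi⟩ := h3 x hx
    exact ⟨U, hU, (hi.indicator measurableSet_Ioc).smul (1 / a : ℂ)⟩
  · refine (isBigO_ofReal_left.2 (isBigO_top_zetaKernelMain ha (s.re + 1))).congr' ?_
      EventuallyEq.rfl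
    filter_upwards [eventually_gt_atTop 1] with t ht
    rw [zetaKernelCut, indicator_of_notMem (fun h => by linarith [h.2]), smul_zero, sub_zero]
  · refine (isBigO_zero_zetaKernel ha).congr' ?_ EventuallyEq.rfl
    filter_upwards [Ioo_mem_nhdsGT (zero_lt_one' ℝ)] with t ht
    rw [zetaKernelCut, indicator_of_mem (mem_Ioc.2 ⟨ht.1, ht.2.le⟩), zetaKernel_eq ha ht.1,
      show (-2 : ℂ) = -((2 : ℕ) : ℂ) by norm_num, cpow_neg, cpow_natCast]
    push_cast
    rw [smul_eq_mul]

lemma differentiableAt_Gamma_mul_zetaFormula {a : ℝ} (ha : 0 < a) {s : ℂ} (hs : 0 < s.re)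
    (hs1 : s ≠ 1) (hs2 : s ≠ 2) :
    DifferentiableAt ℂ (fun s => Gamma s * zetaFormula a s) s := by
  have hac : (a : ℂ) ≠ 0 := ofReal_ne_zero.2 ha.ne'
  have hΓ : DifferentiableAt ℂ Gamma s := differentiableAt_Gamma _ fun m h => by
    rw [h] at hs
    simp at hs
    have : (0 : ℝ) ≤ m := by positivity
    linarith
  have h1 : DifferentiableAt ℂ riemannZeta s := differentiableAt_riemannZeta hs1
  have h2 : DifferentiableAt ℂ (fun s => riemannZeta (s - 1)) s :=
    DifferentiableAt.comp (f := fun s : ℂ => s - 1) s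
      (differentiableAt_riemannZeta fun h => hs2 (by linear_combination h)) (by fun_prop)
  have h3 : DifferentiableAt ℂ (fun s : ℂ => (a : ℂ) ^ s) s :=
    DifferentiableAt.const_cpow differentiableAt_id (Or.inl hac)
  refine hΓ.mul (DifferentiableAt.add (h1.div (h3.const_mul 2) ?_) (h2.div (by fun_prop) ?_))
  · simp [cpow_eq_zero_iff, hac]
  · exact mul_ne_zero (sub_ne_zero.2 hs1) hac

/-- Analytic continuation from Re s > 2 to Re s > 0: the cut kernel has a holomorphic Mellin
transform on the whole right half-plane. -/
lemma mellin_zetaKernelCut {a : ℝ} (ha : 0 < a) {s : ℂ} (hs : 0 < s.re) (hs1 : s ≠ 1)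
    (hs2 : s ≠ 2) :
    mellin (zetaKernelCut a) s = Gamma s * zetaFormula a s - 1 / (a * (s - 2)) := by
  have hac : (a : ℂ) ≠ 0 := ofReal_ne_zero.2 ha.ne'
  set H : ℂ → ℂ := fun s =>
    mellin (zetaKernelCut a) s - (Gamma s * zetaFormula a s - 1 / (a * (s - 2))) with hH
  have hdiff : ∀ z : ℂ, 0 < z.re → z ≠ 1 → z ≠ 2 → DifferentiableAt ℂ H z := fun z hz h1 h2 =>
    (differentiableAt_mellin_zetaKernelCut ha hz).sub
      ((differentiableAt_Gamma_mul_zetaFormula ha hz h1 h2).sub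
        ((differentiableAt_const _).div (by fun_prop) (mul_ne_zero hac (sub_ne_zero.2 h2))))
  have hfar : ∀ z : ℂ, 2 < z.re → H z = 0 := fun z hz => by
    simp only [hH, (hasMellin_zetaKernelCut ha hz).2, sub_self]
  have hoff : ∀ z : ℂ, 0 < z.re → z.im ≠ 0 → H z = 0 := by
    intro z hz hzi
    -- The open quadrant containing z is convex and avoids the points 1 and 2, so the identity
    -- theorem applies without treating a punctured half-plane.
    set Q : Set ℂ := {w | 0 < w.re} ∩ {w | 0 < z.im * w.im} with hQ
    have hQo : IsOpen Q :=
      (isOpen_lt continuous_const continuous_re).inter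
        (isOpen_lt continuous_const (continuous_const.mul continuous_im))
    have hQc : Convex ℝ Q := (convex_halfSpace_re_gt 0).inter (by
      intro x hx y hy p q hp hq hpq
      simp only [mem_ofPred_eq, add_im, real_smul, im_ofReal_mul] at hx hy ⊢
      rcases hp.eq_or_lt with rfl | hp
      · have : q = 1 := by linarith
        subst this; simpa using hy
      · nlinarith [mul_pos hp hx, mul_nonneg hq hy.le])
    have hQd : DifferentiableOn ℂ H Q := fun w hw => by
      have hwi : w.im ≠ 0 := fun h => by
        have := hw.2
        simp [h] at this
      exact (hdiff w hw.1 (fun h => hwi (by simp [h])) (fun h => hwi (by simp [h]))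
        ).differentiableWithinAt
    have hw0 : (3 + z.im * I : ℂ) ∈ Q := by
      refine ⟨by simp, ?_⟩
      simp only [mem_ofPred_eq, add_im, mul_im, ofReal_re, I_im, ofReal_im, I_re]
      have := mul_self_pos.2 hzi
      simpa using this
    have := (hQd.analyticOnNhd hQo).eqOn_zero_of_preconnected_of_eventuallyEq_zero
      hQc.isPreconnected hw0 (by
        have : ∀ᶠ w : ℂ in 𝓝 (3 + z.im * I : ℂ), 2 < w.re :=
          (isOpen_lt continuous_const continuous_re).mem_nhds (by simp; norm_num)
        filter_upwards [this] with w hw using hfar w hw)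
    exact this ⟨hz, mul_self_pos.2 hzi⟩
  have hzero : H s = 0 := by
    have hc : ContinuousAt H s := (hdiff s hs hs1 hs2).continuousAt
    by_cases hsi : s.im = 0
    · have hl : Tendsto (fun ε : ℝ => s + ε * I) (𝓝[>] 0) (𝓝 s) := by
        have : Continuous fun ε : ℝ => s + ε * I := by fun_prop
        exact (this.tendsto' 0 s (by simp)).mono_left nhdsWithin_le_nhds
      refine tendsto_nhds_unique (hc.tendsto.comp hl) (tendsto_const_nhds.congr' ?_)
      filter_upwards [self_mem_nhdsWithin] with ε hε
      exact (hoff _ (by simpa using hs) (by simpa [hsi] using ne_of_gt hε)).symm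
    · exact hoff s hs hsi
  exact sub_eq_zero.1 hzero

/-- For Re s < 2 the remaining tail of t^(-2) on (1, ∞) contributes -1/(s - 2), which cancels the
term left by the cut on (0, 1]. -/
lemma mellin_zetaKernel {a : ℝ} (ha : 0 < a) {s : ℂ} (hs0 : 0 < s.re) (hs2 : s.re < 2)
    (hs1 : s ≠ 1) :
    mellin (fun t => (zetaKernel a t : ℂ)) s = Gamma s * zetaFormula a s := by
  have hs2' : s ≠ 2 := fun h => by rw [h] at hs2; simp at hs2
  have hs2'' : s - 2 ≠ 0 := sub_ne_zero.2 hs2'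
  have hac : (a : ℂ) ≠ 0 := ofReal_ne_zero.2 ha.ne'
  set T : ℝ → ℂ := indicator (Ioi 1) (fun t : ℝ => (t : ℂ) ^ (-2 : ℂ)) with hT
  have e0 : ∀ t : ℝ, 1 < t → (t : ℂ) ^ (s - 1) • (t : ℂ) ^ (-2 : ℂ) = (t : ℂ) ^ (s - 3) := by
    intro t ht
    have htc : (t : ℂ) ≠ 0 := ofReal_ne_zero.2 (by linarith)
    rw [smul_eq_mul, ← cpow_add _ _ htc]
    congr 1; ring
  have eT : ∀ t : ℝ, (t : ℂ) ^ (s - 1) • T t =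
      indicator (Ioi 1) (fun t : ℝ => (t : ℂ) ^ (s - 3)) t := by
    intro t
    by_cases ht : t ∈ Ioi (1 : ℝ)
    · rw [hT, indicator_of_mem ht, indicator_of_mem ht, e0 t ht]
    · rw [hT, indicator_of_notMem ht, indicator_of_notMem ht, smul_zero]
  have hre : (s - 3).re < -1 := by simp; linarith
  have hsub : Ioi (1 : ℝ) ∩ Ioi 0 = Ioi 1 :=
    inter_eq_left.2 (Ioi_subset_Ioi zero_le_one)
  have cT : MellinConvergent T s := by
    rw [MellinConvergent]
    simp_rw [eT]
    rw [integrableOn_indicator_iff measurableSet_Ioi, hsub]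
    exact integrableOn_Ioi_cpow_of_lt hre one_pos
  have mT : mellin T s = -1 / (s - 2) := by
    rw [mellin]
    simp_rw [eT]
    rw [setIntegral_indicator measurableSet_Ioi, inter_comm, hsub,
      integral_Ioi_cpow_of_lt hre one_pos, ofReal_one, one_cpow]
    congr 1; ring
  have h := hasMellin_add (mellinConvergent_zetaKernel ha hs0 hs2) (cT.const_smul (1 / a : ℂ))
  have e1 : mellin (fun t => (zetaKernel a t : ℂ) + (1 / a : ℂ) • T t) s =
      mellin (zetaKernelCut a) s := by
    refine setIntegral_congr_fun measurableSet_Ioi fun t ht => ?_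
    simp only
    congr 1
    have ht0 : (0 : ℝ) < t := ht
    rw [zetaKernelCut, zetaKernel_eq ha ht]
    have e2 : (t : ℂ) ^ (-2 : ℂ) = ((t : ℂ) ^ 2)⁻¹ := by
      rw [show (-2 : ℂ) = -((2 : ℕ) : ℂ) by norm_num, cpow_neg, cpow_natCast]
    rcases le_or_gt t 1 with h1 | h1
    · rw [hT, indicator_of_notMem (by simpa using h1), indicator_of_mem (mem_Ioc.2 ⟨ht0, h1⟩), e2]
      push_cast
      simp
    · rw [hT, indicator_of_mem (mem_Ioi.2 h1), indicator_of_notMem (fun h => by linarith [h.2]), e2]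
      push_cast
      simp
  have h2 := h.2
  rw [e1, mellin_zetaKernelCut ha hs0 hs1 hs2', mellin_const_smul, mT, smul_eq_mul] at h2
  have e3 : (1 : ℂ) / a * (-1 / (s - 2)) = -(1 / (a * (s - 2))) := by
    field_simp
  rw [e3] at h2
  linear_combination -h2

lemma continuousAt_mellin_zetaKernel_div_Gamma {a : ℝ} (ha : 0 < a) {s : ℂ} (hs0 : 0 < s.re) (hs2 : s.re < 2) :
    ContinuousAt (fun s => mellin (fun t => (zetaKernel a t : ℂ)) s / Gamma s) s :=
  ((differentiableAt_mellin_zetaKernel ha hs0 hs2).div (differentiableAt_Gamma _ fun m h => by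
    rw [h] at hs0
    simp at hs0
    have : (0 : ℝ) ≤ m := by positivity
    linarith) (Gamma_ne_zero_of_re_pos hs0)).continuousAt

/-- The right side is continuous across s = 1, so it is also the limit used there. -/
lemma zetaTerms_eq {a : ℝ} (ha : 0 < a) {s : ℂ} (hs0 : 0 < s.re) (hs2 : s.re < 2) :
    zetaTerms a s = mellin (fun t => (zetaKernel a t : ℂ)) s / Gamma s := by
  have hne : ∀ s : ℂ, 0 < s.re → s.re < 2 → s ≠ 1 →
      zetaFormula a s = mellin (fun t => (zetaKernel a t : ℂ)) s / Gamma s := by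
    intro s hs0 hs2 hs1
    rw [mellin_zetaKernel ha hs0 hs2 hs1, mul_div_cancel_left₀ _ (Gamma_ne_zero_of_re_pos hs0)]
  rw [zetaTerms]
  split_ifs with h
  · subst h
    refine Tendsto.limUnder_eq ?_
    refine ((continuousAt_mellin_zetaKernel_div_Gamma ha hs0 hs2).tendsto.mono_left nhdsWithin_le_nhds).congr' ?_
    have h1 : ∀ᶠ w : ℂ in 𝓝 1, 0 < w.re ∧ w.re < 2 :=
      (isOpen_Ioo.preimage continuous_re).mem_nhds ⟨hs0, hs2⟩
    filter_upwards [nhdsWithin_le_nhds h1, self_mem_nhdsWithin] with w hw hw1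
    exact (hne w hw.1 hw.2 hw1).symm
  · exact hne s hs0 hs2 h

lemma continuousAt_zetaTerms {a : ℝ} (ha : 0 < a) {s : ℂ} (hs0 : 0 < s.re) (hs2 : s.re < 2) :
    ContinuousAt (zetaTerms a) s := by
  refine (continuousAt_mellin_zetaKernel_div_Gamma ha hs0 hs2).congr ?_
  have h1 : ∀ᶠ w : ℂ in 𝓝 s, 0 < w.re ∧ w.re < 2 :=
    (isOpen_Ioo.preimage continuous_re).mem_nhds ⟨hs0, hs2⟩
  filter_upwards [h1] with w hw
  exact (zetaTerms_eq ha hw.1 hw.2).symm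

/-! ### The Lommel series as a Mellin transform -/

/-- The integrand attached to the factorization `m = p.1 * p.2`. -/
def factorIntegrand (s : ℂ) (a : ℝ) (p : ℕ × ℕ) (t : ℝ) : ℂ :=
  (t : ℂ) ^ s * ((Real.exp (-(a * p.1) * t) / (t ^ 2 + 4 * Real.pi ^ 2 * p.2 ^ 2) : ℝ) : ℂ)

/-- The contribution of the factorization `m = p.1 * p.2`. -/
def factorIntegral (s : ℂ) (a : ℝ) (p : ℕ × ℕ) : ℂ := ∫ t in Ioi (0 : ℝ), factorIntegrand s a p t

/-- The substitution x = t/(2πk) makes the exponential depend on d alone and the rational factor on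
k alone. -/
lemma cpow_mul_laplacePow {s : ℂ} {a : ℝ} {d k : ℕ} (hk : 0 < k) :
    (k : ℂ) ^ (s - 1) * laplacePow (cauchyKernel 1) (s + 1) (2 * Real.pi * (d * k : ℕ) * a) =
      (2 * Real.pi : ℂ) ^ (1 - s) * factorIntegral s a (d, k) := by
  have hkr : (0 : ℝ) < k := by exact_mod_cast hk
  have hkc : (k : ℂ) ≠ 0 := by exact_mod_cast hk.ne'
  have hpi := Real.pi_pos
  have hq : (0 : ℝ) < (2 * Real.pi * k)⁻¹ := by positivity
  have h2pi : (2 * Real.pi : ℂ) ≠ 0 := by exact_mod_cast (by positivity : (0:ℝ) < 2 * Real.pi).ne'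
  have h := mellin_comp_mul_left (fun x : ℝ => ((cauchyKernel 1 x *
    Real.exp (-(2 * Real.pi * (d * k : ℕ) * a) * x) : ℝ) : ℂ)) (s + 1) hq
  have hL : laplacePow (cauchyKernel 1) (s + 1) (2 * Real.pi * (d * k : ℕ) * a) =
    mellin (fun x : ℝ => ((cauchyKernel 1 x *
      Real.exp (-(2 * Real.pi * (d * k : ℕ) * a) * x) : ℝ) : ℂ)) (s + 1) := rfl
  have hF : mellin (fun t : ℝ => ((cauchyKernel 1 ((2 * Real.pi * k)⁻¹ * t) *
      Real.exp (-(2 * Real.pi * (d * k : ℕ) * a) * ((2 * Real.pi * k)⁻¹ * t)) : ℝ) : ℂ)) (s + 1) =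
      (2 * Real.pi * k : ℂ) ^ 2 * factorIntegral s a (d, k) := by
    rw [factorIntegral, ← integral_const_mul, mellin]
    refine setIntegral_congr_fun measurableSet_Ioi fun t ht => ?_
    have e1 : -(2 * Real.pi * ((d * k : ℕ) : ℝ) * a) * ((2 * Real.pi * k)⁻¹ * t) =
        -(a * d) * t := by
      push_cast
      field_simp
    have e2 : cauchyKernel 1 ((2 * Real.pi * k)⁻¹ * t) =
        (2 * Real.pi * k) ^ 2 / (t ^ 2 + 4 * Real.pi ^ 2 * k ^ 2) := by
      have : 0 < t ^ 2 + 4 * Real.pi ^ 2 * k ^ 2 := by positivity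
      have : 0 < 1 + ((2 * Real.pi * k)⁻¹ * t) ^ 2 := by positivity
      rw [cauchyKernel, pow_one, inv_eq_one_div, div_eq_div_iff (by positivity) (by positivity)]
      field_simp
      ring
    simp only [e1, e2, factorIntegrand, smul_eq_mul, add_sub_cancel_right]
    push_cast
    ring
  rw [hF] at h
  have e3 : (((2 * Real.pi * k)⁻¹ : ℝ) : ℂ) ^ (-(s + 1)) =
      (2 * Real.pi : ℂ) ^ (s + 1) * (k : ℂ) ^ (s + 1) := by
    have := mul_cpow_ofReal_nonneg (a := 2 * Real.pi) (b := k) (by positivity) hkr.le (s + 1)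
    push_cast at this ⊢
    rw [← this, inv_cpow, cpow_neg, inv_inv]
    rw [show (2 * Real.pi * k : ℂ) = ((2 * Real.pi * k : ℝ) : ℂ) by push_cast; ring,
      arg_ofReal_of_nonneg (by positivity)]
    exact hpi.ne
  rw [e3, smul_eq_mul, ← hL] at h
  have e4 : (2 * Real.pi : ℂ) ^ (s + 1) = (2 * Real.pi) ^ 2 / (2 * Real.pi : ℂ) ^ (1 - s) := by
    rw [show s + 1 = (2 : ℕ) - (1 - s) by push_cast; ring, cpow_sub _ _ h2pi, cpow_natCast]
  have e5 : (k : ℂ) ^ (s + 1) = (k : ℂ) ^ (s - 1) * k ^ 2 := by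
    rw [show s + 1 = s - 1 + (2 : ℕ) by push_cast; ring, cpow_add _ _ hkc, cpow_natCast]
  have h6 : (2 * Real.pi : ℂ) ^ (1 - s) ≠ 0 := by
    rw [Ne, cpow_eq_zero_iff]; tauto
  rw [e4, e5] at h
  field_simp at h
  linear_combination -h

lemma lommelTerm_eq {s : ℂ} (hs0 : 0 < s.re) (hs2 : s.re < 2) {a : ℝ} (ha : 0 < a) (m : ℕ+) :
    lommelTerm s a m = (2 * Real.pi * a : ℂ) ^ (-(1 / 2) : ℂ) / Gamma (s + 1) *
      (2 * Real.pi : ℂ) ^ (1 - s) * ∑ p ∈ (m : ℕ).divisorsAntidiagonal, factorIntegral s a p := by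
  have hm : (0 : ℝ) < m := by exact_mod_cast m.pos
  have hmc : ((m : ℕ) : ℂ) ≠ 0 := by exact_mod_cast m.pos.ne'
  have hpi := Real.pi_pos
  have e1 : (2 * Real.pi * (m : ℕ) * a : ℂ) = ((2 * Real.pi * (m : ℕ) * a : ℝ) : ℂ) := by
    push_cast; ring
  rw [lommelTerm, e1, lommelS_half hs0 hs2 (by positivity), lommelIntegral, sigmaC,
    ← Nat.sum_divisorsAntidiagonal (fun d _ : ℕ => (d : ℂ) ^ (1 - s)), Finset.sum_mul,
    Finset.sum_mul, Finset.mul_sum]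
  refine Finset.sum_congr rfl fun p hp => ?_
  obtain ⟨hpm, -⟩ := Nat.mem_divisorsAntidiagonal.1 hp
  have hp0 : p.1 * p.2 ≠ 0 := by rw [hpm]; exact m.ne_zero
  have hp1 : 0 < p.1 := Nat.pos_of_ne_zero (left_ne_zero_of_mul hp0)
  have hp2 : 0 < p.2 := Nat.pos_of_ne_zero (right_ne_zero_of_mul hp0)
  have hp1c : (p.1 : ℂ) ≠ 0 := by exact_mod_cast hp1.ne'
  have key := cpow_mul_laplacePow (s := s) (a := a) (d := p.1) hp2
  rw [hpm] at key
  have e2 : ((2 * Real.pi * (m : ℕ) * a : ℝ) : ℂ) ^ (-(1 / 2) : ℂ) =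
      (2 * Real.pi * a : ℂ) ^ (-(1 / 2) : ℂ) * ((m : ℕ) : ℂ) ^ (-(1 / 2) : ℂ) := by
    have := mul_cpow_ofReal_nonneg (a := 2 * Real.pi * a) (b := (m : ℕ)) (by positivity) hm.le
      (-(1 / 2) : ℂ)
    push_cast at this ⊢
    rw [← this]
    congr 1; ring
  -- With the divisor weight d^(1-s), the power (dk)^(s-1) leaves only k^(s-1).
  have e3 : ((m : ℕ) : ℂ) ^ (s - 1 / 2) * ((m : ℕ) : ℂ) ^ (-(1 / 2) : ℂ) =
      (p.1 : ℂ) ^ (s - 1) * (p.2 : ℂ) ^ (s - 1) := by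
    rw [← cpow_add _ _ hmc, show s - 1 / 2 + -(1 / 2) = s - 1 by ring, ← hpm, Nat.cast_mul,
      natCast_mul_natCast_cpow]
  have e4 : (p.1 : ℂ) ^ (1 - s) * (p.1 : ℂ) ^ (s - 1) = 1 := by
    rw [← cpow_add _ _ hp1c]; simp
  rw [e2]
  linear_combination ((p.1 : ℂ) ^ (1 - s) * (2 * Real.pi * a : ℂ) ^ (-(1 / 2) : ℂ) / Gamma (s + 1) *
      laplacePow (cauchyKernel 1) (s + 1) (2 * Real.pi * (m : ℕ) * a)) * e3 +
    ((2 * Real.pi * a : ℂ) ^ (-(1 / 2) : ℂ) / Gamma (s + 1) * (p.2 : ℂ) ^ (s - 1) *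
      laplacePow (cauchyKernel 1) (s + 1) (2 * Real.pi * (m : ℕ) * a)) * e4 +
    ((2 * Real.pi * a : ℂ) ^ (-(1 / 2) : ℂ) / Gamma (s + 1)) * key

lemma norm_factorIntegrand_le {s : ℂ} {a : ℝ} (p : ℕ+ × ℕ+) {t : ℝ} (ht : 0 < t) :
    ‖factorIntegrand s a (p.1, p.2) t‖ ≤
      ((p.2 : ℝ) ^ 2)⁻¹ * (t ^ (s.re + 1 - 1) * Real.exp (-(a * p.1) * t)) := by
  have hk : (0 : ℝ) < p.2 := by exact_mod_cast p.2.pos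
  have h1 : (p.2 : ℝ) ^ 2 ≤ t ^ 2 + 4 * Real.pi ^ 2 * p.2 ^ 2 := by
    have h9 : (9 : ℝ) ≤ Real.pi ^ 2 := by nlinarith [Real.pi_gt_three]
    nlinarith [sq_nonneg t, sq_nonneg (p.2 : ℝ)]
  rw [factorIntegrand, norm_mul, norm_cpow_eq_rpow_re_of_pos ht, norm_real, Real.norm_eq_abs,
    abs_of_nonneg (by positivity), add_sub_cancel_right, div_eq_mul_inv]
  have : 0 ≤ t ^ s.re := Real.rpow_nonneg ht.le _
  calc t ^ s.re * (Real.exp (-(a * p.1) * t) * (t ^ 2 + 4 * Real.pi ^ 2 * p.2 ^ 2)⁻¹)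
      ≤ t ^ s.re * (Real.exp (-(a * p.1) * t) * ((p.2 : ℝ) ^ 2)⁻¹) := by gcongr
    _ = _ := by ring

lemma integrableOn_factorIntegrand {s : ℂ} (hs0 : 0 < s.re) {a : ℝ} (ha : 0 < a) (p : ℕ+ × ℕ+) :
    IntegrableOn (factorIntegrand s a (p.1, p.2)) (Ioi 0) := by
  have hd : (0 : ℝ) < p.1 := by exact_mod_cast p.1.pos
  refine ((integrableOn_rpow_mul_exp (r := s.re + 1) (by linarith)
    (by positivity : 0 < a * p.1)).const_mul ((p.2 : ℝ) ^ 2)⁻¹).mono' ?_ ?_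
  · exact ((measurable_cpow_ofReal _).mul (by fun_prop)).aestronglyMeasurable
  · exact (ae_restrict_iff' measurableSet_Ioi).2 (Eventually.of_forall fun t ht =>
      norm_factorIntegrand_le p ht)

/-- Dropping all but k² from the denominator bounds the integral by a constant times d^(-Re s - 1)
k^(-2), a product of two convergent series. -/
lemma summable_integral_norm_factorIntegrand {s : ℂ} (hs0 : 0 < s.re) {a : ℝ} (ha : 0 < a) :
    Summable fun p : ℕ+ × ℕ+ => ∫ t in Ioi (0 : ℝ), ‖factorIntegrand s a (p.1, p.2) t‖ := by
  have h1 : Summable fun d : ℕ+ => (1 / (d : ℝ)) ^ (s.re + 1) := by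
    have := (Real.summable_one_div_nat_rpow.2 (by linarith : 1 < s.re + 1)).comp_injective
      PNat.coe_injective
    refine this.congr fun d => ?_
    simp only [Function.comp]
    rw [Real.div_rpow zero_le_one (by positivity), Real.one_rpow]
  have h2 := (h1.mul_of_nonneg summable_pnat_inv_sq (fun d => by positivity)
    (fun k => by positivity)).mul_left ((1 / a) ^ (s.re + 1) * Real.Gamma (s.re + 1))
  refine Summable.of_nonneg_of_le (fun p => integral_nonneg fun t => norm_nonneg _)
    (fun p => ?_) h2
  have hd : (0 : ℝ) < p.1 := by exact_mod_cast p.1.pos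
  have hs1 : 0 < s.re + 1 := by linarith
  have hi := (integrableOn_rpow_mul_exp hs1 (by positivity : 0 < a * p.1)).const_mul
    ((p.2 : ℝ) ^ 2)⁻¹
  refine (setIntegral_mono_on (integrableOn_factorIntegrand hs0 ha p).norm hi measurableSet_Ioi
    fun t ht => norm_factorIntegrand_le p ht).trans (le_of_eq ?_)
  have h3 : ∫ t in Ioi (0 : ℝ), t ^ (s.re + 1 - 1) * Real.exp (-(a * p.1) * t) =
      (1 / (a * p.1)) ^ (s.re + 1) * Real.Gamma (s.re + 1) := by
    simpa only [neg_mul] using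
      Real.integral_rpow_mul_exp_neg_mul_Ioi hs1 (by positivity : 0 < a * p.1)
  rw [integral_const_mul, h3, ← one_div_mul_one_div,
    Real.mul_rpow (by positivity) (by positivity)]
  ring

lemma hasSum_factorIntegrand (s : ℂ) {a : ℝ} (ha : 0 < a) {t : ℝ} (ht : 0 < t) :
    HasSum (fun p : ℕ+ × ℕ+ => factorIntegrand s a (p.1, p.2) t)
      ((t : ℂ) ^ (s - 1) • ((bose (a * t) * oddBose t : ℝ) : ℂ) / 2) := by
  have htc : (t : ℂ) ≠ 0 := ofReal_ne_zero.2 ht.ne'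
  have h1 : HasSum (fun d : ℕ+ => Real.exp (-(a * d) * t)) (bose (a * t)) := by
    have := hasSum_bose (mul_pos ha ht)
    rw [← Equiv.pnatEquivNat.hasSum_iff] at this
    refine this.congr_fun fun d => ?_
    simp only [Function.comp, Equiv.pnatEquivNat_apply]
    have hd : ((PNat.natPred d : ℕ) : ℝ) + 1 = d := by exact_mod_cast d.natPred_add_one
    rw [hd]
    congr 1
    ring
  have h2 := (hasSum_oddBose ht).div_const (2 * t)
  have h3 := h1.mul h2 (h1.summable.mul_of_nonneg h2.summable (fun d => (Real.exp_pos _).le)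
    (fun k => by positivity))
  have h4 := (hasSum_ofReal.2 h3).mul_left ((t : ℂ) ^ s)
  have e1 : ∀ p : ℕ+ × ℕ+, (t : ℂ) ^ s * ((Real.exp (-(a * p.1) * t) *
      (2 * t / (t ^ 2 + 4 * Real.pi ^ 2 * p.2 ^ 2) / (2 * t)) : ℝ) : ℂ) =
      factorIntegrand s a (p.1, p.2) t := by
    intro p
    rw [factorIntegrand, div_right_comm, div_self (by positivity : (2 * t) ≠ 0), mul_one_div]
  have e2 : (t : ℂ) ^ s * ((bose (a * t) * (oddBose t / (2 * t)) : ℝ) : ℂ) =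
      (t : ℂ) ^ (s - 1) • ((bose (a * t) * oddBose t : ℝ) : ℂ) / 2 := by
    rw [cpow_sub _ _ htc, cpow_one, smul_eq_mul]
    push_cast
    field_simp
  simpa only [e1, e2] using h4

lemma hasSum_factorIntegral {s : ℂ} (hs0 : 0 < s.re) {a : ℝ} (ha : 0 < a) :
    HasSum (fun p : ℕ+ × ℕ+ => factorIntegral s a (p.1, p.2))
      (mellin (fun t => ((bose (a * t) * oddBose t : ℝ) : ℂ)) s / 2) := by
  have h := hasSum_integral_of_summable_integral_norm
    (F := fun p : ℕ+ × ℕ+ => factorIntegrand s a (p.1, p.2))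
    (integrableOn_factorIntegrand hs0 ha) (summable_integral_norm_factorIntegrand hs0 ha)
  rw [setIntegral_congr_fun measurableSet_Ioi fun t ht => (hasSum_factorIntegrand s ha ht).tsum_eq,
    integral_div] at h
  exact h

lemma hasSum_lommelTerm {s : ℂ} (hs0 : 0 < s.re) (hs2 : s.re < 2) {a : ℝ} (ha : 0 < a) :
    HasSum (fun m : ℕ+ => lommelTerm s a m)
      ((2 * Real.pi * a : ℂ) ^ (-(1 / 2) : ℂ) / Gamma (s + 1) * (2 * Real.pi : ℂ) ^ (1 - s) *
        (mellin (fun t => ((bose (a * t) * oddBose t : ℝ) : ℂ)) s / 2)) := by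
  have h := hasSum_factorIntegral hs0 ha
  -- Absolute convergence over pairs (d, k) allows regrouping by the product m = dk.
  rw [← sigmaAntidiagonalEquivProd.hasSum_iff] at h
  have h2 := h.sigma fun m => hasSum_fintype _
  simp_rw [lommelTerm_eq hs0 hs2 ha]
  refine HasSum.mul_left _ ?_
  refine h2.congr_fun ?_
  intro m
  exact (Finset.sum_coe_sort (m : ℕ).divisorsAntidiagonal (factorIntegral s a)).symm

lemma prefactor_mul_tsum_lommelTerm {s : ℂ} (hs0 : 0 < s.re) (hs2 : s.re < 2) {a : ℝ}
    (ha : 0 < a) :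
    2 * s * (2 * Real.pi : ℂ) ^ (s - 1 / 2) * (Real.sqrt a : ℂ) * ∑' m : ℕ+, lommelTerm s a m =
      mellin (fun t => ((bose (a * t) * oddBose t : ℝ) : ℂ)) s / Gamma s := by
  have hs : s ≠ 0 := fun h => by rw [h] at hs0; simp at hs0
  have h2pi : (2 * Real.pi : ℂ) ≠ 0 := by
    exact_mod_cast (by positivity : (0 : ℝ) < 2 * Real.pi).ne'
  have hac : (a : ℂ) ≠ 0 := ofReal_ne_zero.2 ha.ne'
  have hΓ := Gamma_ne_zero_of_re_pos hs0
  have e1 : (2 * Real.pi * a : ℂ) ^ (-(1 / 2) : ℂ) =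
      (2 * Real.pi : ℂ) ^ (-(1 / 2) : ℂ) * (a : ℂ) ^ (-(1 / 2) : ℂ) := by
    have := mul_cpow_ofReal_nonneg (a := 2 * Real.pi) (b := a) (by positivity) ha.le
      (-(1 / 2) : ℂ)
    push_cast at this
    exact this
  have e2 : (Real.sqrt a : ℂ) * (a : ℂ) ^ (-(1 / 2) : ℂ) = 1 := by
    rw [Real.sqrt_eq_rpow, ofReal_cpow ha.le, ← cpow_add _ _ hac]
    simp
  have e3 : (2 * Real.pi : ℂ) ^ (s - 1 / 2) * (2 * Real.pi : ℂ) ^ (-(1 / 2) : ℂ) *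
      (2 * Real.pi : ℂ) ^ (1 - s) = 1 := by
    rw [← cpow_add _ _ h2pi, ← cpow_add _ _ h2pi,
      show s - 1 / 2 + -(1 / 2) + (1 - s) = 0 by ring, cpow_zero]
  rw [(hasSum_lommelTerm hs0 hs2 ha).tsum_eq, e1, Gamma_add_one _ hs]
  set M := mellin (fun t => ((bose (a * t) * oddBose t : ℝ) : ℂ)) s
  calc _ = ((2 * Real.pi : ℂ) ^ (s - 1 / 2) * (2 * Real.pi : ℂ) ^ (-(1 / 2) : ℂ) *
      (2 * Real.pi : ℂ) ^ (1 - s)) * ((Real.sqrt a : ℂ) * (a : ℂ) ^ (-(1 / 2) : ℂ)) *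
      (2 * s / (s * Gamma s) * (M / 2)) := by ring
    _ = M / Gamma s := by
      rw [e2, e3]
      field_simp

/-! ### The symmetric kernel and the transformation formula -/

lemma mellinConvergent_boseDiff_mul {s : ℂ} (hs0 : 0 < s.re) (hs2 : s.re < 2) {a : ℝ}
    (ha : 0 < a) :
    MellinConvergent (fun t => ((boseDiff t * boseDiff (a * t) : ℝ) : ℂ)) s := by
  refine mellinConvergent_of_isBigO_rpow (a := 2) (b := 0) (locallyIntegrableOn_ofReal
    (continuousOn_boseDiff.mul (continuousOn_boseDiff_mul ha))) ?_ hs2 ?_ hs0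
  · refine Asymptotics.IsBigO.of_bound (1 / a) ?_
    filter_upwards [eventually_gt_atTop 0] with t ht
    have h1 := abs_boseDiff_le_inv ht
    have h2 := abs_boseDiff_le_inv (mul_pos ha ht)
    rw [norm_real, norm_mul, Real.rpow_neg ht.le, Real.rpow_ofNat,
      Real.norm_of_nonneg (by positivity : 0 ≤ (t ^ 2)⁻¹)]
    calc ‖boseDiff t‖ * ‖boseDiff (a * t)‖ ≤ 1 / t * (1 / (a * t)) := by
          exact mul_le_mul h1 h2 (norm_nonneg _) (by positivity)
      _ = 1 / a * (t ^ 2)⁻¹ := by field_simp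
  · refine Asymptotics.IsBigO.of_bound 1 ?_
    filter_upwards [self_mem_nhdsWithin] with t ht
    have h1 := abs_boseDiff_le_half ht
    have h2 := abs_boseDiff_le_half (mul_pos ha ht)
    rw [norm_real, norm_mul, neg_zero, Real.rpow_zero, norm_one, mul_one]
    calc ‖boseDiff t‖ * ‖boseDiff (a * t)‖ ≤ 1 / 2 * (1 / 2) :=
          mul_le_mul h1 h2 (norm_nonneg _) (by positivity)
      _ ≤ 1 := by norm_num

/-- Writing D for `boseDiff`, one has `bose (a * t)` = D(at) + 1/(at) and `oddBose t` = D(t) + 1/2;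
in their product everything but D(t) D(at) is `zetaKernel a t`. -/
lemma lommel_sub_zetaTerms {s : ℂ} (hs0 : 0 < s.re) (hs2 : s.re < 2) {a : ℝ} (ha : 0 < a) :
    2 * s * (2 * Real.pi : ℂ) ^ (s - 1 / 2) * (Real.sqrt a : ℂ) * ∑' m : ℕ+, lommelTerm s a m -
        zetaTerms a s =
      mellin (fun t => ((boseDiff t * boseDiff (a * t) : ℝ) : ℂ)) s / Gamma s := by
  rw [prefactor_mul_tsum_lommelTerm hs0 hs2 ha, zetaTerms_eq ha hs0 hs2, ← sub_div]
  congr 1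
  rw [sub_eq_iff_eq_add, ← (hasMellin_add (mellinConvergent_boseDiff_mul hs0 hs2 ha)
    (mellinConvergent_zetaKernel ha hs0 hs2)).2]
  refine setIntegral_congr_fun measurableSet_Ioi fun t ht => ?_
  have ht0 : (0 : ℝ) < t := ht
  simp only
  congr 1
  rw [← ofReal_add]
  congr 1
  simp only [zetaKernel, boseDiff, oddBose]
  field_simp
  ring

/-- Replacing t by αt in D(t) D(βt) gives D(αt) D(t), because αβ = 1. -/
lemma mellin_boseDiff_mul_symm (s : ℂ) {α β : ℝ} (hα : 0 < α) (hαβ : α * β = 1) :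
    mellin (fun t => ((boseDiff t * boseDiff (α * t) : ℝ) : ℂ)) s =
      (α : ℂ) ^ (-s) * mellin (fun t => ((boseDiff t * boseDiff (β * t) : ℝ) : ℂ)) s := by
  rw [← smul_eq_mul, ← mellin_comp_mul_left _ s hα]
  congr 1
  ext t
  rw [← mul_assoc β α t, mul_comm β α, hαβ, one_mul, mul_comm]

end LommelZeta
end

theorem corollary3p2 (s : ℂ) (hs0 : 0 < s.re) (hs2 : s.re < 2)
    (α β : ℝ) (hα : 0 < α) (hβ : 0 < β) (hαβ : α * β = 1) :
    (∀ a : ℝ, 0 < a →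
      Summable (fun m : ℕ+ => LommelZeta.lommelTerm s a m) ∧
      (∀ m : ℕ+, ContinuousAt
        (fun μ : ℂ => LommelZeta.lommelS μ (1 / 2) (2 * Real.pi * m * a)) (-s - 1 / 2)) ∧
      ContinuousAt (LommelZeta.zetaTerms a) s) ∧
    (α : ℂ) ^ (s / 2) *
        (2 * s * (2 * Real.pi : ℂ) ^ (s - 1 / 2) * (Real.sqrt α : ℂ) *
            ∑' m : ℕ+, LommelZeta.lommelTerm s α m
          - LommelZeta.zetaTerms α s) =
      (β : ℂ) ^ (s / 2) *
        (2 * s * (2 * Real.pi : ℂ) ^ (s - 1 / 2) * (Real.sqrt β : ℂ) *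
            ∑' m : ℕ+, LommelZeta.lommelTerm s β m
          - LommelZeta.zetaTerms β s) := by
  refine ⟨fun a ha => ⟨(LommelZeta.hasSum_lommelTerm hs0 hs2 ha).summable, fun m => ?_,
    LommelZeta.continuousAt_zetaTerms ha hs0 hs2⟩, ?_⟩
  · have hm : (0 : ℝ) < m := by exact_mod_cast m.pos
    have h := LommelZeta.continuousAt_lommelS_half hs0 hs2
      (by positivity : 0 < 2 * Real.pi * (m : ℕ) * a)
    push_cast at h
    exact h
  · have hαc : (α : ℂ) ≠ 0 := Complex.ofReal_ne_zero.2 hα.ne'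
    have hβ' : (β : ℂ) = (α : ℂ)⁻¹ := by
      refine eq_inv_of_mul_eq_one_right ?_
      exact_mod_cast hαβ
    rw [LommelZeta.lommel_sub_zetaTerms hs0 hs2 hα, LommelZeta.lommel_sub_zetaTerms hs0 hs2 hβ,
      LommelZeta.mellin_boseDiff_mul_symm s hα hαβ, hβ', Complex.inv_cpow _ _ (by
        rw [Complex.arg_ofReal_of_nonneg hα.le]; exact Real.pi_pos.ne), ← Complex.cpow_neg,
      mul_div_assoc, ← mul_assoc, ← Complex.cpow_add _ _ hαc]
    -- What remains is the exponent identity s/2 - s = -s/2.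
    congr 2
    ring
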